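/- Let $V$ be a finite-dimensional real Hilbert space, let $\mathcal A$ be a unital $C^*$-algebra (for instance the bounded operators on a complex Hilbert space) and let $\omega:\mathcal A\to\mathbb C$ be a state, i.e. a continuous linear functional with $\omega(a^*a)\ge 0$ and $\omega(1)=1$. A $V$-Grassmann random variable is a unital real-algebra homomorphism $X:\Lambda V\to\mathcal A$ on the exterior algebra; write $G(X)=X(G)$. For $G\in\Lambda V$, $w\in V$ let $\langle\partial_R G,w\rangle$ be the right derivative of $G$ paired with $w$, the linear map with $$\langle\partial_R(f_1\cdots f_n),w\rangle=\sum_{k=1}^n(-1)^{n-k}\langle f_k,w\rangle\, f_1\cdots f_{k-1}f_{k+1}\cdots f_n ,\qquad f_1,\dots,f_n\in V.$$ For a real Hilbert space $W$ and a bounded antisymmetric operator $D$ on $W$, a $W$-Grassmann variable $X$ is (centered) Gaussian with correlation $D$ if it is continuous on $W$ and $\omega(X(G)X(f))=\omega(X(\langle\partial_R G,Df\rangle))$ for all $G\in\Lambda W$, $f\in W$. A Brownian motion with correlation $C$ is a process $B_t(v)=\Xi(\mathbb 1_{[0,t]}\otimes v)$, $t\ge 0$, $v \in V$, where $\Xi$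 is Gaussian over $L^2(\mathbb R;V)$ with correlation $C$ acting pointwise. Two Grassmann variables $X$ over $W_1$ and $Y$ over $W_2$ are independent if they are compatible (they extend jointly to a homomorphism on $\Lambda(W_1\oplus W_2)$) and $\omega(X(F)Y(H))=\omega(X(F))\,\omega(Y(H))$ for all $F\in\Lambda W_1$, $H\in\Lambda W_2$. Let $A,C:V\to V$ be linear with $C$ antisymmetric, such that the integral $$C_A=\int_0^\infty e^{A^Ts}\,C\,e^{As}\,ds$$ converges absolutely (for instance, all eigenvalues of $A$ have strictly negative real part). Let $U\in\Lambda V$ be even. Let $B$ be a Brownian motion with correlation $C$ and let $\Psi_0$ be a Gaussian $V$-Grassmann variable with correlation $C_A$, independent of $B$ (that is, of $(B_{t_1},\dots,B_{t_n})$ for all times $t_1,\dots,t_n\ge0$). Consider the stochastic differential equation $$\Psi_t(v)=\Psi_0(v)+\int_0^t\Psi_s\bigl(Av-\langle\partial_R U,Cv\rangle\bigr)\,ds+B_t(v),\qquad t\ge 0,\ v\in V,$$ whose solutions are continuous families $(\Psi_t)$ of $V$-Grassmann variables. If $$A^TC_A=C_AA,$$ then the continuous linear functional $\tilde\omega(\cdot)=\omega(\,\cdot\,e^{-2U(\Psi_0)})$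 on $\mathcal A$ is an invariant measure for this equation: for every solution $\Psi$ (global, or on an interval $[0,T]$), every $G\in\Lambda V$ and every $t$ in its time interval, $$\tilde\omega(G(\Psi_t))=\tilde\omega(G(\Psi_0)).$$ -/

import Mathlib

open MeasureTheory

noncomputable section

namespace GrassmannSDE

/-- The state of a quantum probability space `(𝒜, ω)`, with `𝒜` a unital C⋆-algebra: a continuous,
positive and normalized linear functional. -/
structure IsState {𝒜 : Type*} [CStarAlgebra 𝒜] (ω : 𝒜 →L[ℂ] ℂ) : Prop where
  nonneg : ∀ a : 𝒜, 0 ≤ (ω (star a * a)).re ∧ (ω (star a * a)).im = 0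
  map_one : ω 1 = 1

/-- `V`-Grassmann random variables with values in `𝒜`: unital algebra homomorphisms `ΛV → 𝒜`. -/
abbrev GrassmannVar (V 𝒜 : Type*) [AddCommGroup V] [Module ℝ V] [CStarAlgebra 𝒜] : Type _ :=
  ExteriorAlgebra ℝ V →ₐ[ℝ] 𝒜

section Algebraic

variable {V W 𝒜 : Type*} [AddCommGroup V] [Module ℝ V] [AddCommGroup W] [Module ℝ W]
  [CStarAlgebra 𝒜]

/-- Two Grassmann variables are compatible when they extend to a homomorphism on `Λ(V ⊕ W)`. -/
def IsCompatible (X : GrassmannVar V 𝒜) (Y : GrassmannVar W 𝒜) : Prop :=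
  ∃ Z : GrassmannVar (V × W) 𝒜,
    (∀ v : V, Z (ExteriorAlgebra.ι ℝ (v, (0 : W))) = X (ExteriorAlgebra.ι ℝ v)) ∧
    (∀ w : W, Z (ExteriorAlgebra.ι ℝ ((0 : V), w)) = Y (ExteriorAlgebra.ι ℝ w))

/-- (Tensor) independence of two Grassmann variables under `ω`; compatibility is included. -/
def IsIndependent (ω : 𝒜 →L[ℂ] ℂ) (X : GrassmannVar V 𝒜) (Y : GrassmannVar W 𝒜) : Prop :=
  IsCompatible X Y ∧
    ∀ (F : ExteriorAlgebra ℝ V) (H : ExteriorAlgebra ℝ W), ω (X F * Y H) = ω (X F) * ω (Y H)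

/-- `X` is compatible with and independent of the process `(B_t)_{t ≥ 0}`: for all times
`t_1, …, t_n` it is compatible with and independent of the joint Grassmann variable
`Y = (B_{t_1}, …, B_{t_n})`, a homomorphism on `Λ(Vⁿ)`. -/
def IsIndependentOfProcess (ω : 𝒜 →L[ℂ] ℂ) (X : GrassmannVar W 𝒜) (B : ℝ → GrassmannVar V 𝒜) :
    Prop :=
  ∀ (n : ℕ) (t : Fin n → ℝ), (∀ i, 0 ≤ t i) →
    ∃ Y : GrassmannVar (Fin n → V) 𝒜,
      (∀ (i : Fin n) (v : V),
        Y (ExteriorAlgebra.ι ℝ (Pi.single i v)) = B (t i) (ExteriorAlgebra.ι ℝ v)) ∧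
      IsIndependent ω X Y

end Algebraic

section Gaussian

variable {V 𝒜 : Type*} [NormedAddCommGroup V] [InnerProductSpace ℝ V] [CStarAlgebra 𝒜]

/-- The pairing `⟨∂_R G, w⟩` of the right derivative `∂_R G ∈ ΛV ⊗ V` with `w ∈ V`, where
`⟨f ⊗ v, w⟩ = f ⟨v, w⟩`. It is the right contraction of `G` with the linear form `⟨w, ·⟩`:
`⟨∂_R (f₁ ⋯ fₙ), w⟩ = ∑ₖ (-1)^(n-k) ⟨fₖ, w⟩ f₁ ⋯ fₖ₋₁ fₖ₊₁ ⋯ fₙ`. -/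
def rightDeriv (G : ExteriorAlgebra ℝ V) (w : V) : ExteriorAlgebra ℝ V :=
  CliffordAlgebra.contractRight G (innerₗ V w)

/-- The Leibniz rule of the right derivative. -/
theorem rightDeriv_mul_ι (G : ExteriorAlgebra ℝ V) (v w : V) :
    rightDeriv (G * ExteriorAlgebra.ι ℝ v) w =
      inner ℝ v w • G - rightDeriv G w * ExteriorAlgebra.ι ℝ v := by
  have h := CliffordAlgebra.contractRight_mul_ι (Q := (0 : QuadraticForm ℝ V)) (innerₗ V w) v G
  rw [real_inner_comm]
  exact h

/-- `X` is a centered `V`-Grassmann Gaussian variable with correlation `C` under `ω`: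
`ω(X(G) X(f)) = ω(X(⟨∂_R G, C f⟩))`, and `X` is continuous on `V`. -/
structure IsGaussian (ω : 𝒜 →L[ℂ] ℂ) (X : GrassmannVar V 𝒜) (C : V →L[ℝ] V) : Prop where
  integration_by_parts : ∀ (G : ExteriorAlgebra ℝ V) (f : V),
    ω (X G * X (ExteriorAlgebra.ι ℝ f)) = ω (X (rightDeriv G (C f)))
  continuous : Continuous fun f : V => X (ExteriorAlgebra.ι ℝ f)

/-- `B` is a `V`-valued Grassmann Brownian motion with correlation `C`: `B_t(v) = Ξ(𝟙_[0,t] ⊗ v)`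
for a one-dimensional white noise `Ξ`, that is a Gaussian variable over `L²(ℝ; V)` whose
correlation is `C` acting pointwise. -/
def IsBrownianMotion (ω : 𝒜 →L[ℂ] ℂ) (B : ℝ → GrassmannVar V 𝒜) (C : V →L[ℝ] V) : Prop :=
  ∃ Ξ : GrassmannVar (Lp V 2 (volume : Measure ℝ)) 𝒜,
    IsGaussian ω Ξ (C.compLpL 2 (volume : Measure ℝ)) ∧
    ∀ t : ℝ, 0 ≤ t → ∀ v : V,
      B t (ExteriorAlgebra.ι ℝ v) =
        Ξ (ExteriorAlgebra.ι ℝ (indicatorConstLp 2 (measurableSet_Icc (a := (0 : ℝ)) (b := t))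
          measure_Icc_lt_top.ne v))

/-- `Ψ` is a solution on `[0, T]` of the additive SDE driven by `B` with drift `F : V → ΛV` and
initial condition `Ψ₀`. As `V` is finite dimensional in all uses, continuity in `t` of `Ψ_t` in the
norm `sup_{|v| = 1} ‖Ψ_t(v)‖` is continuity of `Ψ_t(v)` for every `v`. -/
structure IsSolution (F : V →ₗ[ℝ] ExteriorAlgebra ℝ V) (B : ℝ → GrassmannVar V 𝒜)
    (Ψ₀ : GrassmannVar V 𝒜) (T : ℝ) (Ψ : ℝ → GrassmannVar V 𝒜) : Prop where
  continuousOn : ∀ v : V, ContinuousOn (fun t => Ψ t (ExteriorAlgebra.ι ℝ v)) (Set.Icc 0 T)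
  equation : ∀ t ∈ Set.Icc (0 : ℝ) T, ∀ v : V,
    Ψ t (ExteriorAlgebra.ι ℝ v) =
      Ψ₀ (ExteriorAlgebra.ι ℝ v) + (∫ s in (0 : ℝ)..t, Ψ s (F v)) + B t (ExteriorAlgebra.ι ℝ v)

/-- The continuous linear functional `ρ` is an invariant measure for the SDE driven by `B` with
drift `F` and initial condition `Ψ₀`: `ρ(G(Ψ_t)) = ρ(G(Ψ_0))` for every `G ∈ ΛV`, every solution
`Ψ` (on any time interval `[0, T]`, so in particular every global one) and every time `t` in its
interval. -/
def IsInvariantMeasure (ρ : 𝒜 →L[ℂ] ℂ) (F : V →ₗ[ℝ] ExteriorAlgebra ℝ V)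
    (B : ℝ → GrassmannVar V 𝒜) (Ψ₀ : GrassmannVar V 𝒜) : Prop :=
  ∀ (T : ℝ) (Ψ : ℝ → GrassmannVar V 𝒜), 0 < T → IsSolution F B Ψ₀ T Ψ →
    ∀ (G : ExteriorAlgebra ℝ V), ∀ t ∈ Set.Icc (0 : ℝ) T, ρ (Ψ t G) = ρ (Ψ₀ G)

/-- The drift `v ↦ A v - ⟨∂_R U, C v⟩`. -/
def drift (A C : V →L[ℝ] V) (U : ExteriorAlgebra ℝ V) : V →ₗ[ℝ] ExteriorAlgebra ℝ V :=
  (ExteriorAlgebra.ι ℝ) ∘ₗ (A : V →ₗ[ℝ] V) -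
    (CliffordAlgebra.contractRight (Q := (0 : QuadraticForm ℝ V)) U) ∘ₗ (innerₗ V) ∘ₗ
      (C : V →ₗ[ℝ] V)

/-- The drift in terms of the right derivative. -/
theorem drift_apply (A C : V →L[ℝ] V) (U : ExteriorAlgebra ℝ V) (v : V) :
    drift A C U v = ExteriorAlgebra.ι ℝ (A v) - rightDeriv U (C v) := rfl

/-- The integrand `e^{Aᵀ s} C e^{A s}` of the stationary covariance. -/
def covIntegrand [CompleteSpace V] (A C : V →L[ℝ] V) (s : ℝ) : V →L[ℝ] V :=
  NormedSpace.exp (s • ContinuousLinearMap.adjoint A) ∘L C ∘L NormedSpace.exp (s • A)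

/-- The covariance `C_A = ∫₀^∞ e^{Aᵀ s} C e^{A s} ds`. -/
def stationaryCov [CompleteSpace V] (A C : V →L[ℝ] V) : V →L[ℝ] V :=
  ∫ s in Set.Ioi (0 : ℝ), covIntegrand A C s

/-- The even part `Λ_even V` of the Grassmann algebra. -/
def evenPart (V : Type*) [AddCommGroup V] [Module ℝ V] : Submodule ℝ (ExteriorAlgebra ℝ V) :=
  CliffordAlgebra.evenOdd (0 : QuadraticForm ℝ V) 0

/-- The functional `ω(· a)`. -/
def weighted (ω : 𝒜 →L[ℂ] ℂ) (a : 𝒜) : 𝒜 →L[ℂ] ℂ :=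
  ω ∘L (ContinuousLinearMap.mul ℂ 𝒜).flip a

end Gaussian

end GrassmannSDE

end

noncomputable section

namespace GrassmannSDE

/-! ### Right derivative and parity in the exterior algebra. -/

section RightDeriv

variable {V : Type*} [NormedAddCommGroup V] [InnerProductSpace ℝ V]

/-! Write `E = e^{-2Ψ₀(U)}`, `∂_w G = ⟨∂_R G, w⟩`, and let `L` be the generator of the equation: a
drift term plus half a second-order term in `C`. Two facts are combined.

Stationarity at time zero: `ω(Ψ₀(L G) E) = 0`. Integrating the derivative of the covariance
integrand gives the Lyapunov equation `AᵀC_A + C_A A = -C`, which the commutation hypothesis turns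
into `C_A A = -C/2` (`stationaryCov_comp_apply`). Gaussian integration by parts under the weight `E`
(`IsGaussian.weighted_ibp`), applied to `H = ∂_e G` and `f = A e`, then gives `ω(Ψ₀(H · Ae) E) =
ω(Ψ₀(-½ ∂_{Ce} H + H ∂_{Ce} U) E)`. So each basis vector `e` contributes zero to `L`
(`weighted_generator_eq_zero`).

Evolution: `d/dt ω(Ψ_t(G) E) = ω(Ψ_t(L G) E)` as a right derivative
(`IsSolution.hasDerivWithinAt_state`). This is an Itô expansion of `Ψ_{t+h}(G)` to order `h`. It
needs the increments after `t` to be centered with covariance `h C` given the past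
(`IsBrownianMotion.increment_past`), and `Ψ_t` to lie in the closed algebra of the past and to
anticommute with those increments (`IsSolution.adapted`). Adaptedness holds for an arbitrary
solution by a Grönwall argument in the quotient of `𝒜` by a closed subspace
(`IsSolution.mem_of_isClosed`).

The difference `δ_t(G) = ω(Ψ_t(G) E) - ω(Ψ₀(G) E)` therefore solves `δ' = δ ∘ L`, `δ_0 = 0`, on the
finite-dimensional space `ΛV`, and vanishes by Grönwall. -/

theorem mul_ι_induction {V : Type*} [AddCommGroup V] [Module ℝ V]
    {P : ExteriorAlgebra ℝ V → Prop} (algebraMap : ∀ r : ℝ, P (algebraMap _ _ r))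
    (add : ∀ x y, P x → P y → P (x + y))
    (mul_ι : ∀ v x, P x → P (x * ExteriorAlgebra.ι ℝ v)) (x : ExteriorAlgebra ℝ V) : P x :=
  CliffordAlgebra.right_induction (Q := (0 : QuadraticForm ℝ V)) algebraMap add mul_ι x

theorem evenPart_induction {V : Type*} [AddCommGroup V] [Module ℝ V]
    {P : ExteriorAlgebra ℝ V → Prop} (algebraMap : ∀ r : ℝ, P (algebraMap _ _ r))
    (add : ∀ x y, P x → P y → P (x + y))
    (ι_mul_ι_mul : ∀ v w x, P x → P (ExteriorAlgebra.ι ℝ v * ExteriorAlgebra.ι ℝ w * x))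
    {x : ExteriorAlgebra ℝ V} (hx : x ∈ evenPart V) : P x :=
  CliffordAlgebra.even_induction (Q := (0 : QuadraticForm ℝ V)) (motive := fun x _ => P x)
    algebraMap (fun x y _ _ => add x y) (fun v w x _ => ι_mul_ι_mul v w x) x hx

/-- The odd part of the Grassmann algebra. -/
def oddPart (V : Type*) [AddCommGroup V] [Module ℝ V] : Submodule ℝ (ExteriorAlgebra ℝ V) :=
  CliffordAlgebra.evenOdd (0 : QuadraticForm ℝ V) 1

theorem oddPart_induction {V : Type*} [AddCommGroup V] [Module ℝ V]
    {P : ExteriorAlgebra ℝ V → Prop} (ι : ∀ v, P (ExteriorAlgebra.ι ℝ v))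
    (add : ∀ x y, P x → P y → P (x + y))
    (ι_mul_ι_mul : ∀ v w x, P x → P (ExteriorAlgebra.ι ℝ v * ExteriorAlgebra.ι ℝ w * x))
    {x : ExteriorAlgebra ℝ V} (hx : x ∈ oddPart V) : P x :=
  CliffordAlgebra.odd_induction (Q := (0 : QuadraticForm ℝ V)) (P := fun x _ => P x)
    ι (fun x y _ _ => add x y) (fun v w x _ => ι_mul_ι_mul v w x) x hx

theorem ι_mem_oddPart {V : Type*} [AddCommGroup V] [Module ℝ V] (v : V) :
    ExteriorAlgebra.ι ℝ v ∈ oddPart V :=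
  CliffordAlgebra.ι_mem_evenOdd_one _ v

theorem ι_mul_ι_mul_mem_oddPart {V : Type*} [AddCommGroup V] [Module ℝ V] (v w : V)
    {x : ExteriorAlgebra ℝ V} (hx : x ∈ oddPart V) :
    ExteriorAlgebra.ι ℝ v * ExteriorAlgebra.ι ℝ w * x ∈ oddPart V := by
  have := CliffordAlgebra.evenOdd_mul_le (0 : QuadraticForm ℝ V) 0 1
  rw [zero_add] at this
  exact this (Submodule.mul_mem_mul (CliffordAlgebra.ι_mul_ι_mem_evenOdd_zero _ v w) hx)

theorem ι_mul_evenPart_mem {V : Type*} [AddCommGroup V] [Module ℝ V] (v : V)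
    {x : ExteriorAlgebra ℝ V} (hx : x ∈ evenPart V) :
    ExteriorAlgebra.ι ℝ v * x ∈ oddPart V := by
  have := CliffordAlgebra.evenOdd_mul_le (0 : QuadraticForm ℝ V) 1 0
  rw [add_zero] at this
  exact this (Submodule.mul_mem_mul (CliffordAlgebra.ι_mem_evenOdd_one _ v) hx)

theorem evenPart_mul_mem {V : Type*} [AddCommGroup V] [Module ℝ V]
    {x y : ExteriorAlgebra ℝ V} (hx : x ∈ evenPart V) (hy : y ∈ evenPart V) :
    x * y ∈ evenPart V := by
  have := CliffordAlgebra.evenOdd_mul_le (0 : QuadraticForm ℝ V) 0 0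
  rw [zero_add] at this
  exact this (Submodule.mul_mem_mul hx hy)

theorem ι_mul_ι_swap {V : Type*} [AddCommGroup V] [Module ℝ V] (v w : V) :
    ExteriorAlgebra.ι ℝ v * ExteriorAlgebra.ι ℝ w =
      -(ExteriorAlgebra.ι ℝ w * ExteriorAlgebra.ι ℝ v) :=
  eq_neg_of_add_eq_zero_left (ExteriorAlgebra.ι_add_mul_swap v w)

/-- The right derivative in direction `w`, as a linear map. -/
def rightDerivₗ (w : V) : ExteriorAlgebra ℝ V →ₗ[ℝ] ExteriorAlgebra ℝ V :=
  (CliffordAlgebra.contractRight (Q := (0 : QuadraticForm ℝ V))).flip (innerₗ V w)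

@[simp] theorem rightDerivₗ_apply (w : V) (G : ExteriorAlgebra ℝ V) :
    rightDerivₗ w G = rightDeriv G w := rfl

@[simp] theorem rightDeriv_zero (w : V) : rightDeriv (0 : ExteriorAlgebra ℝ V) w = 0 :=
  map_zero (rightDerivₗ w)

theorem rightDeriv_add (G H : ExteriorAlgebra ℝ V) (w : V) :
    rightDeriv (G + H) w = rightDeriv G w + rightDeriv H w :=
  map_add (rightDerivₗ w) G H

theorem rightDeriv_sub (G H : ExteriorAlgebra ℝ V) (w : V) :
    rightDeriv (G - H) w = rightDeriv G w - rightDeriv H w :=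
  map_sub (rightDerivₗ w) G H

theorem rightDeriv_smul (r : ℝ) (G : ExteriorAlgebra ℝ V) (w : V) :
    rightDeriv (r • G) w = r • rightDeriv G w :=
  map_smul (rightDerivₗ w) r G

@[simp] theorem rightDeriv_algebraMap (r : ℝ) (w : V) :
    rightDeriv (algebraMap ℝ (ExteriorAlgebra ℝ V) r) w = 0 :=
  CliffordAlgebra.contractRight_algebraMap (Q := (0 : QuadraticForm ℝ V)) (innerₗ V w) r

@[simp] theorem rightDeriv_one (w : V) : rightDeriv (1 : ExteriorAlgebra ℝ V) w = 0 := by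
  rw [← map_one (algebraMap ℝ _), rightDeriv_algebraMap]

/-- The right derivative is linear in the direction. -/
def rightDerivDir (G : ExteriorAlgebra ℝ V) : V →ₗ[ℝ] ExteriorAlgebra ℝ V :=
  CliffordAlgebra.contractRight (Q := (0 : QuadraticForm ℝ V)) G ∘ₗ innerₗ V

@[simp] theorem rightDerivDir_apply (w : V) (G : ExteriorAlgebra ℝ V) :
    rightDerivDir G w = rightDeriv G w := rfl

theorem rightDeriv_smul_dir (r : ℝ) (G : ExteriorAlgebra ℝ V) (w : V) :
    rightDeriv G (r • w) = r • rightDeriv G w :=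
  map_smul (rightDerivDir G) r w

theorem rightDeriv_ι (v w : V) :
    rightDeriv (ExteriorAlgebra.ι ℝ v) w = algebraMap ℝ _ (inner ℝ v w) := by
  have := rightDeriv_mul_ι 1 v w
  simpa [Algebra.algebraMap_eq_smul_one] using this

theorem rightDeriv_mul_ι_mul_ι (G : ExteriorAlgebra ℝ V) (u v w : V) :
    rightDeriv (G * (ExteriorAlgebra.ι ℝ u * ExteriorAlgebra.ι ℝ v)) w =
      G * rightDeriv (ExteriorAlgebra.ι ℝ u * ExteriorAlgebra.ι ℝ v) w +
        rightDeriv G w * (ExteriorAlgebra.ι ℝ u * ExteriorAlgebra.ι ℝ v) := by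
  rw [← mul_assoc, rightDeriv_mul_ι, rightDeriv_mul_ι, rightDeriv_mul_ι, rightDeriv_ι,
    Algebra.algebraMap_eq_smul_one]
  simp only [sub_mul, mul_sub, smul_mul_assoc, mul_smul_comm, one_mul, mul_assoc]
  abel

/-- The right derivative acts from the right and meets an even number of letters of `U` before
reaching `G`, so the signs cancel. -/
theorem rightDeriv_mul_even {U : ExteriorAlgebra ℝ V} (hU : U ∈ evenPart V)
    (G : ExteriorAlgebra ℝ V) (w : V) :
    rightDeriv (G * U) w = G * rightDeriv U w + rightDeriv G w * U := by
  revert G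
  refine evenPart_induction (P := fun U => ∀ G, rightDeriv (G * U) w =
    G * rightDeriv U w + rightDeriv G w * U) (fun r G => ?_) (fun x y hx hy G => ?_)
    (fun u v x hx G => ?_) hU
  · simp [Algebra.algebraMap_eq_smul_one, rightDeriv_smul]
  · rw [mul_add, rightDeriv_add, rightDeriv_add, hx, hy]; noncomm_ring
  · rw [← mul_assoc G, hx, hx, rightDeriv_mul_ι_mul_ι]
    noncomm_ring

theorem rightDeriv_mem_oddPart {U : ExteriorAlgebra ℝ V} (hU : U ∈ evenPart V) (w : V) :
    rightDeriv U w ∈ oddPart V := by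
  -- The inductive step needs that `x` itself is even, which `evenPart_induction` discards.
  induction U, hU using CliffordAlgebra.even_induction with
  | algebraMap r => exact (rightDeriv_algebraMap r w).symm ▸ (oddPart V).zero_mem
  | add x y _ _ hx hy => rw [rightDeriv_add]; exact add_mem hx hy
  | ι_mul_ι_mul u v x h hx =>
    change rightDeriv (ExteriorAlgebra.ι ℝ u * ExteriorAlgebra.ι ℝ v * x) w ∈ _
    rw [rightDeriv_mul_even h]
    refine add_mem (ι_mul_ι_mul_mem_oddPart u v hx) ?_
    rw [rightDeriv_mul_ι, rightDeriv_ι, sub_mul, smul_mul_assoc, ← Algebra.smul_def,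
      smul_mul_assoc]
    exact sub_mem (Submodule.smul_mem _ _ (ι_mul_evenPart_mem u h))
      (Submodule.smul_mem _ _ (ι_mul_evenPart_mem v h))

theorem drift_mem_oddPart (A C : V →L[ℝ] V) {U : ExteriorAlgebra ℝ V} (hU : U ∈ evenPart V)
    (v : V) : drift A C U v ∈ oddPart V := by
  rw [drift_apply]
  exact sub_mem (ι_mem_oddPart _) (rightDeriv_mem_oddPart hU _)

end RightDeriv

/-! ### Signs of even and odd elements against an anticommuting element. -/

section Commutation

variable {V 𝓡 : Type*} [AddCommGroup V] [Module ℝ V] [Ring 𝓡] [Algebra ℝ 𝓡]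

theorem commute_of_even (X : ExteriorAlgebra ℝ V →ₐ[ℝ] 𝓡) {a : 𝓡}
    (ha : ∀ v, X (ExteriorAlgebra.ι ℝ v) * a = -(a * X (ExteriorAlgebra.ι ℝ v)))
    {U : ExteriorAlgebra ℝ V} (hU : U ∈ evenPart V) : Commute (X U) a := by
  refine evenPart_induction (P := fun U => Commute (X U) a) (fun r => ?_) (fun x y hx hy => ?_)
    (fun u v x hx => ?_) hU
  · rw [AlgHom.commutes]; exact Algebra.commutes r a
  · rw [map_add]; exact hx.add_left hy
  · rw [map_mul, map_mul]
    refine Commute.mul_left ?_ hx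
    rw [Commute, SemiconjBy, mul_assoc, ha, mul_neg, ← mul_assoc, ha, neg_mul, neg_neg, mul_assoc]

theorem anticommute_of_odd (X : ExteriorAlgebra ℝ V →ₐ[ℝ] 𝓡) {a : 𝓡}
    (ha : ∀ v, X (ExteriorAlgebra.ι ℝ v) * a = -(a * X (ExteriorAlgebra.ι ℝ v)))
    {U : ExteriorAlgebra ℝ V} (hU : U ∈ oddPart V) : X U * a = -(a * X U) := by
  refine oddPart_induction (P := fun U => X U * a = -(a * X U)) ha (fun x y hx hy => ?_)
    (fun u v x hx => ?_) hU
  · rw [map_add, add_mul, mul_add, hx, hy]; abel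
  · rw [map_mul, map_mul, mul_assoc, hx, mul_neg, mul_assoc, ← mul_assoc _ a, ha, neg_mul,
      mul_neg, neg_neg, ← mul_assoc, ← mul_assoc, ha]
    noncomm_ring

/-- Passing `a` through a word costs one sign per letter, which is the grade involution. -/
theorem involute_swap (X : ExteriorAlgebra ℝ V →ₐ[ℝ] 𝓡) {a : 𝓡}
    (ha : ∀ v, X (ExteriorAlgebra.ι ℝ v) * a = -(a * X (ExteriorAlgebra.ι ℝ v)))
    (G : ExteriorAlgebra ℝ V) :
    a * X G = X (CliffordAlgebra.involute (Q := (0 : QuadraticForm ℝ V)) G) * a := by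
  refine mul_ι_induction (P := fun G => a * X G =
    X (CliffordAlgebra.involute (Q := (0 : QuadraticForm ℝ V)) G) * a) (fun r => ?_)
    (fun x y hx hy => ?_) (fun v x hx => ?_) G
  · have : CliffordAlgebra.involute (Q := (0 : QuadraticForm ℝ V))
        (algebraMap ℝ (ExteriorAlgebra ℝ V) r) = algebraMap ℝ _ r := AlgHom.commutes _ r
    rw [this, AlgHom.commutes]; exact (Algebra.commutes r a).symm
  · have : CliffordAlgebra.involute (Q := (0 : QuadraticForm ℝ V)) (x + y) =
      CliffordAlgebra.involute (Q := (0 : QuadraticForm ℝ V)) x +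
      CliffordAlgebra.involute (Q := (0 : QuadraticForm ℝ V)) y := map_add _ x y
    rw [this, map_add, map_add, mul_add, add_mul, hx, hy]
  · have : CliffordAlgebra.involute (Q := (0 : QuadraticForm ℝ V)) (x * ExteriorAlgebra.ι ℝ v) =
      CliffordAlgebra.involute (Q := (0 : QuadraticForm ℝ V)) x * -ExteriorAlgebra.ι ℝ v := by
      rw [← CliffordAlgebra.involute_ι]; exact map_mul _ x (ExteriorAlgebra.ι ℝ v)
    rw [this, map_mul, map_mul, map_neg, ← mul_assoc, hx, mul_assoc, mul_assoc, neg_mul, ha,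
      neg_neg]

theorem even_central {U : ExteriorAlgebra ℝ V} (hU : U ∈ evenPart V) (G : ExteriorAlgebra ℝ V) :
    Commute U G := by
  refine mul_ι_induction (P := fun G => Commute U G) (fun r => (Algebra.commutes r U).symm)
    (fun x y hx hy => hx.add_right hy) (fun v x hx => hx.mul_right ?_) G
  exact commute_of_even (AlgHom.id ℝ _) (fun w => ι_mul_ι_swap w v) hU

end Commutation

/-! ### The generator and its Leibniz rule. -/

section Generator

variable {V : Type*} [NormedAddCommGroup V] [InnerProductSpace ℝ V] [FiniteDimensional ℝ V]

/-- The generator of the additive Grassmann SDE with drift `F` and noise correlation `C`: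
`G ↦ ∑ᵢ ⟨∂_R G, eᵢ⟩ F(eᵢ) + ½ ∑ᵢ ⟨∂_R ⟨∂_R G, eᵢ⟩, C eᵢ⟩`. -/
def generator (F : V →ₗ[ℝ] ExteriorAlgebra ℝ V) (C : V →L[ℝ] V) :
    ExteriorAlgebra ℝ V →ₗ[ℝ] ExteriorAlgebra ℝ V :=
  ∑ i, (LinearMap.mulRight ℝ (F (stdOrthonormalBasis ℝ V i)) +
    (1 / 2 : ℝ) • rightDerivₗ (C (stdOrthonormalBasis ℝ V i))) ∘ₗ
      rightDerivₗ (stdOrthonormalBasis ℝ V i)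

theorem generator_apply (F : V →ₗ[ℝ] ExteriorAlgebra ℝ V) (C : V →L[ℝ] V)
    (G : ExteriorAlgebra ℝ V) :
    generator F C G = ∑ i, (rightDeriv G (stdOrthonormalBasis ℝ V i) *
      F (stdOrthonormalBasis ℝ V i) + (1 / 2 : ℝ) •
      rightDeriv (rightDeriv G (stdOrthonormalBasis ℝ V i)) (C (stdOrthonormalBasis ℝ V i))) := by
  simp [generator, LinearMap.sum_apply]

theorem generator_algebraMap (F : V →ₗ[ℝ] ExteriorAlgebra ℝ V) (C : V →L[ℝ] V) (r : ℝ) :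
    generator F C (algebraMap ℝ _ r) = 0 := by
  simp [generator_apply]

/-- The Leibniz rule of the generator, with the bracket `⟨∂_R G, C v⟩` as correction. -/
theorem generator_mul_ι (F : V →ₗ[ℝ] ExteriorAlgebra ℝ V) (hF : ∀ v, F v ∈ oddPart V)
    (C : V →L[ℝ] V) (hC : ∀ v w : V, inner ℝ (C v) w = -inner ℝ v (C w))
    (G : ExteriorAlgebra ℝ V) (v : V) :
    generator F C (G * ExteriorAlgebra.ι ℝ v) =
      generator F C G * ExteriorAlgebra.ι ℝ v + G * F v + rightDeriv G (C v) := by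
  set e := stdOrthonormalBasis ℝ V
  have hFι : ∀ i, F (e i) * ExteriorAlgebra.ι ℝ v = -(ExteriorAlgebra.ι ℝ v * F (e i)) := fun i =>
    anticommute_of_odd (AlgHom.id ℝ _) (fun w => ι_mul_ι_swap w v) (hF _)
  have hv : ∀ w : V, ∑ i, (inner ℝ w (e i) : ℝ) • e i = w := fun w => by
    simpa only [real_inner_comm] using e.sum_repr' w
  have h1 : G * F v = ∑ i, (inner ℝ v (e i) : ℝ) • (G * F (e i)) := by
    conv_lhs => rw [← hv v]
    simp [Finset.mul_sum]
  -- The second-order term applied to `G v` has two cross terms, expanding `v` and `C v` in the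
  -- basis. By antisymmetry of `C` each sums to `⟨∂_R G, C v⟩`, and the factor `1/2` makes the total
  -- one copy.
  have h2 : rightDeriv G (C v) = ∑ i, (1 / 2 : ℝ) • ((inner ℝ v (e i) : ℝ) •
      rightDeriv G (C (e i)) + (inner ℝ (C v) (e i) : ℝ) • rightDeriv G (e i)) := by
    have h3 : rightDeriv G (C v) = ∑ i, (inner ℝ v (e i) : ℝ) • rightDeriv G (C (e i)) := by
      conv_lhs => rw [← hv v]
      rw [← rightDerivDir_apply]
      simp
    have h4 : rightDeriv G (C v) = ∑ i, (inner ℝ (C v) (e i) : ℝ) • rightDeriv G (e i) := by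
      conv_lhs => rw [← hv (C v)]
      rw [← rightDerivDir_apply]
      simp
    rw [← Finset.smul_sum, Finset.sum_add_distrib, ← h3, ← h4]
    module
  rw [h1, h2, generator_apply, generator_apply, Finset.sum_mul, ← Finset.sum_add_distrib,
    ← Finset.sum_add_distrib]
  refine Finset.sum_congr rfl fun i _ => ?_
  change rightDeriv (G * ExteriorAlgebra.ι ℝ v) (e i) * F (e i) + (1 / 2 : ℝ) •
      rightDeriv (rightDeriv (G * ExteriorAlgebra.ι ℝ v) (e i)) (C (e i)) =
    (rightDeriv G (e i) * F (e i) + (1 / 2 : ℝ) • rightDeriv (rightDeriv G (e i)) (C (e i))) *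
      ExteriorAlgebra.ι ℝ v + _ + _
  rw [rightDeriv_mul_ι, rightDeriv_sub, rightDeriv_smul, rightDeriv_mul_ι, sub_mul, add_mul,
    mul_assoc, mul_assoc, hFι, hC v, smul_mul_assoc, smul_mul_assoc, mul_neg]
  module

end Generator

/-! ### The Lyapunov equation for the stationary covariance. -/

section Lyapunov

variable {V : Type*} [NormedAddCommGroup V] [InnerProductSpace ℝ V] [CompleteSpace V]

theorem hasDerivAt_covIntegrand (A C : V →L[ℝ] V) (s : ℝ) :
    HasDerivAt (covIntegrand A C)
      (ContinuousLinearMap.adjoint A ∘L covIntegrand A C s + covIntegrand A C s ∘L A) s := by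
  have h1 := hasDerivAt_exp_smul_const' (𝕂 := ℝ) (ContinuousLinearMap.adjoint A) s
  have h2 := hasDerivAt_exp_smul_const (𝕂 := ℝ) A s
  have h := h1.mul ((h2.const_mul C))
  refine HasDerivAt.congr_deriv (f := covIntegrand A C) h ?_
  simp only [covIntegrand, ← ContinuousLinearMap.mul_def, mul_assoc]

/-- The Lyapunov equation of the stationary covariance. -/
theorem stationaryCov_lyapunov (A C : V →L[ℝ] V)
    (hint : IntegrableOn (covIntegrand A C) (Set.Ioi (0 : ℝ))) :
    ContinuousLinearMap.adjoint A ∘L stationaryCov A C + stationaryCov A C ∘L A = -C := by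
  have hl : IntegrableOn (fun s => ContinuousLinearMap.adjoint A ∘L covIntegrand A C s)
      (Set.Ioi (0 : ℝ)) :=
    (ContinuousLinearMap.compL ℝ V V V (ContinuousLinearMap.adjoint A)).integrable_comp hint
  have hr : IntegrableOn (fun s => covIntegrand A C s ∘L A) (Set.Ioi (0 : ℝ)) :=
    ((ContinuousLinearMap.compL ℝ V V V).flip A).integrable_comp hint
  have hd : IntegrableOn (fun s => ContinuousLinearMap.adjoint A ∘L covIntegrand A C s +
      covIntegrand A C s ∘L A) (Set.Ioi (0 : ℝ)) :=
    (ContinuousLinearMap.compL ℝ V V V (ContinuousLinearMap.adjoint A) +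
      (ContinuousLinearMap.compL ℝ V V V).flip A).integrable_comp hint
  -- The integrand and its derivative are both integrable, so the boundary term at infinity vanishes
  -- without any spectral condition on `A`.
  have hlim := tendsto_zero_of_hasDerivAt_of_integrableOn_Ioi
    (fun s _ => hasDerivAt_covIntegrand A C s) hd hint
  have h := integral_Ioi_of_hasDerivAt_of_tendsto'
    (fun s _ => hasDerivAt_covIntegrand A C s) hd hlim
  rw [integral_add hl hr] at h
  have e1 := (ContinuousLinearMap.compL ℝ V V V
    (ContinuousLinearMap.adjoint A)).integral_comp_comm hint
  have e2 := ((ContinuousLinearMap.compL ℝ V V V).flip A).integral_comp_comm hint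
  simp only [ContinuousLinearMap.flip_apply, ContinuousLinearMap.compL_apply] at e1 e2
  rw [e1, e2] at h
  rw [stationaryCov, h, covIntegrand]
  ext v; simp [NormedSpace.exp_zero]

/-- Commutation makes the two terms of the Lyapunov equation equal: `2 C_A A = -C`. -/
theorem stationaryCov_comp_apply (A C : V →L[ℝ] V)
    (hint : IntegrableOn (covIntegrand A C) (Set.Ioi (0 : ℝ)))
    (hcomm : ContinuousLinearMap.adjoint A ∘L stationaryCov A C = stationaryCov A C ∘L A)
    (v : V) : stationaryCov A C (A v) = (-(1 / 2) : ℝ) • C v := by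
  have h := stationaryCov_lyapunov A C hint
  rw [hcomm] at h
  have h' := congrArg (fun L : V →L[ℝ] V => L v) h
  simp only [add_apply, neg_apply, ContinuousLinearMap.comp_apply] at h'
  rw [← two_smul ℝ] at h'
  rw [neg_smul, ← smul_neg, ← h', smul_smul]
  norm_num

end Lyapunov

/-! ### The exponential weight as a limit of even polynomials. -/

section Weight

variable {V 𝒜 : Type*} [NormedAddCommGroup V] [InnerProductSpace ℝ V] [CStarAlgebra 𝒜]

/-- The partial sums of the exponential series of `-2 U`. -/
def expPartial (U : ExteriorAlgebra ℝ V) (N : ℕ) : ExteriorAlgebra ℝ V :=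
  ∑ n ∈ Finset.range N, ((n.factorial : ℝ)⁻¹ * (-2) ^ n) • U ^ n

theorem pow_mem_evenPart {U : ExteriorAlgebra ℝ V} (hU : U ∈ evenPart V) (n : ℕ) :
    U ^ n ∈ evenPart V := by
  induction n with
  | zero => rw [pow_zero]; exact SetLike.one_mem_graded _
  | succ n ih => rw [pow_succ]; exact evenPart_mul_mem ih hU

theorem expPartial_mem_evenPart {U : ExteriorAlgebra ℝ V} (hU : U ∈ evenPart V) (N : ℕ) :
    expPartial U N ∈ evenPart V :=
  Submodule.sum_mem _ fun n _ => Submodule.smul_mem _ _ (pow_mem_evenPart hU n)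

theorem rightDeriv_pow {U : ExteriorAlgebra ℝ V} (hU : U ∈ evenPart V) (n : ℕ) (w : V) :
    rightDeriv (U ^ (n + 1)) w = ((n + 1 : ℕ) : ℝ) • (rightDeriv U w * U ^ n) := by
  induction n with
  | zero => simp
  | succ n ih =>
    rw [pow_succ, rightDeriv_mul_even hU, ih, ((even_central hU _).pow_left _).eq,
      smul_mul_assoc, mul_assoc, ← pow_succ]
    push_cast
    module

/-- Even elements are central, so the usual power rule applies; differentiation lowers the exponent
by one, hence the shift from `N + 1` to `N`. -/
theorem rightDeriv_expPartial {U : ExteriorAlgebra ℝ V} (hU : U ∈ evenPart V) (N : ℕ) (w : V) :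
    rightDeriv (expPartial U (N + 1)) w = (-2 : ℝ) • (rightDeriv U w * expPartial U N) := by
  rw [expPartial, expPartial, ← rightDerivₗ_apply, map_sum, Finset.sum_range_succ']
  simp only [map_smul, rightDerivₗ_apply, pow_zero, rightDeriv_one, smul_zero, add_zero,
    Finset.mul_sum, Finset.smul_sum]
  refine Finset.sum_congr rfl fun n _ => ?_
  rw [rightDeriv_pow hU, mul_smul_comm, smul_smul, smul_smul, Nat.factorial_succ]
  congr 1
  have : (n.factorial : ℝ) ≠ 0 := by positivity
  push_cast
  field_simp
  ring

theorem tendsto_expPartial (X : GrassmannVar V 𝒜) (U : ExteriorAlgebra ℝ V) :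
    Filter.Tendsto (fun N => X (expPartial U N)) Filter.atTop
      (nhds (NormedSpace.exp ((-2 : ℝ) • X U))) := by
  have h := (NormedSpace.exp_series_hasSum_exp' (𝕂 := ℝ) ((-2 : ℝ) • X U)).tendsto_sum_nat
  refine h.congr fun N => ?_
  simp only [expPartial, map_sum, map_smul, map_pow, smul_pow, smul_smul]

end Weight

/-! ### Stationarity of the weighted Gaussian under the generator. -/

section Invariance

theorem map_real_smul {𝒜 : Type*} [CStarAlgebra 𝒜] (ω : 𝒜 →L[ℂ] ℂ) (r : ℝ) (a : 𝒜) :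
    ω (r • a) = r • ω a :=
  LinearMap.map_smul_of_tower (ω : 𝒜 →ₗ[ℂ] ℂ) r a

variable {V 𝒜 : Type*} [NormedAddCommGroup V] [InnerProductSpace ℝ V] [CStarAlgebra 𝒜]

/-- Gaussian integration by parts under the weight `e^{-2U}`. -/
theorem IsGaussian.weighted_ibp {ω : 𝒜 →L[ℂ] ℂ} {X : GrassmannVar V 𝒜} {D : V →L[ℝ] V}
    (hX : IsGaussian ω X D) {U : ExteriorAlgebra ℝ V} (hU : U ∈ evenPart V)
    (G : ExteriorAlgebra ℝ V) (f : V) :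
    ω (X (G * ExteriorAlgebra.ι ℝ f) * NormedSpace.exp ((-2 : ℝ) • X U)) =
      ω (X (rightDeriv G (D f) - (2 : ℝ) • (G * rightDeriv U (D f))) *
        NormedSpace.exp ((-2 : ℝ) • X U)) := by
  -- Integration by parts is available for elements of the exterior algebra only; it is applied to
  -- the partial sums, and `ω` is continuous.
  have hlim : ∀ H : ExteriorAlgebra ℝ V, Filter.Tendsto (fun N => ω (X (H * expPartial U N)))
      Filter.atTop (nhds (ω (X H * NormedSpace.exp ((-2 : ℝ) • X U)))) := fun H => by
    simp only [map_mul]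
    exact (ω.continuous.tendsto _).comp ((tendsto_expPartial X U).const_mul _)
  have h1 := (hlim (G * ExteriorAlgebra.ι ℝ f)).comp (Filter.tendsto_add_atTop_nat 1)
  have h2 := (((hlim (rightDeriv G (D f))).comp (Filter.tendsto_add_atTop_nat 1))).sub
    ((hlim (G * rightDeriv U (D f))).const_smul (2 : ℝ))
  have h3 : ω (X (rightDeriv G (D f) - (2 : ℝ) • (G * rightDeriv U (D f))) *
        NormedSpace.exp ((-2 : ℝ) • X U)) =
      ω (X (rightDeriv G (D f)) * NormedSpace.exp ((-2 : ℝ) • X U)) - (2 : ℝ) •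
        ω (X (G * rightDeriv U (D f)) * NormedSpace.exp ((-2 : ℝ) • X U)) := by
    rw [map_sub, map_smul, sub_mul, smul_mul_assoc, map_sub, map_real_smul]
  rw [h3]
  refine tendsto_nhds_unique h1 (h2.congr fun N => ?_)
  simp only [Function.comp_apply]
  have hE := expPartial_mem_evenPart hU (N + 1)
  have hswap : G * ExteriorAlgebra.ι ℝ f * expPartial U (N + 1) =
      G * expPartial U (N + 1) * ExteriorAlgebra.ι ℝ f := by
    rw [mul_assoc, (even_central hE _).symm.eq, mul_assoc]
  rw [hswap, map_mul X (G * expPartial U (N + 1)),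
    hX.integration_by_parts, rightDeriv_mul_even hE, rightDeriv_expPartial hU, mul_smul_comm,
    map_add, map_smul, map_add, map_real_smul, mul_assoc]
  module

/-- The sum vanishes term by term: weighted integration by parts with `f = A e` and `C_A A = -C/2`
produces exactly the remaining drift and second-order terms. The `2` in the weight cancels the
`1/2`. -/
theorem weighted_generator_eq_zero [FiniteDimensional ℝ V] [CompleteSpace V] {ω : 𝒜 →L[ℂ] ℂ}
    {A C : V →L[ℝ] V} (hint : IntegrableOn (covIntegrand A C) (Set.Ioi (0 : ℝ)))
    (hcomm : ContinuousLinearMap.adjoint A ∘L stationaryCov A C = stationaryCov A C ∘L A)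
    {U : ExteriorAlgebra ℝ V} (hU : U ∈ evenPart V) {X : GrassmannVar V 𝒜}
    (hX : IsGaussian ω X (stationaryCov A C)) (G : ExteriorAlgebra ℝ V) :
    ω (X (generator (drift A C U) C G) * NormedSpace.exp ((-2 : ℝ) • X U)) = 0 := by
  rw [generator_apply, map_sum, Finset.sum_mul, map_sum]
  refine Finset.sum_eq_zero fun i _ => ?_
  set H := rightDeriv G (stdOrthonormalBasis ℝ V i)
  set e := stdOrthonormalBasis ℝ V i
  have h := hX.weighted_ibp hU H (A e)
  rw [stationaryCov_comp_apply A C hint hcomm, rightDeriv_smul_dir, rightDeriv_smul_dir,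
    mul_smul_comm] at h
  rw [drift_apply, mul_sub]
  simp only [map_add, map_sub, map_smul, sub_mul, add_mul, smul_mul_assoc, map_real_smul]
    at h ⊢
  rw [h]
  module

end Invariance

/-! ### Distance to a closed subspace stable under triple products. -/

section Quotient

variable {𝒜 : Type*} [CStarAlgebra 𝒜]

/-- The infimum defining the quotient norm need not be attained; the factor `2` leaves room for an
actual element. Closedness makes the norm of a nonzero class positive. -/
theorem exists_mem_norm_sub_le (O : Submodule ℝ 𝒜) (hO : IsClosed (O : Set 𝒜)) (a : 𝒜) :
    ∃ b ∈ O, ‖a - b‖ ≤ 2 * ‖O.mkQ a‖ := by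
  by_cases h : O.mkQ a = 0
  · refine ⟨a, by simpa using h, by simp⟩
  · have hpos : 0 < ‖O.mkQ a‖ := by
      have : IsClosed (O : Set 𝒜) := hO
      exact norm_pos_iff.mpr h
    obtain ⟨m, hm, hlt⟩ := Submodule.Quotient.norm_mk_lt (O.mkQ a) hpos
    refine ⟨a - m, ?_, by rw [sub_sub_cancel]; linarith⟩
    rw [← Submodule.Quotient.mk_eq_zero, Submodule.Quotient.mk_sub, hm]
    simp

/-- The distance of a triple product to a closed subspace that is stable under triple products. -/
theorem norm_mkQ_mul_mul_le (O : Submodule ℝ 𝒜) (hO : IsClosed (O : Set 𝒜))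
    (hmul : ∀ a ∈ O, ∀ b ∈ O, ∀ c ∈ O, a * b * c ∈ O) {R : ℝ} {a b c : 𝒜}
    (ha : ‖a‖ ≤ R) (hb : ‖b‖ ≤ R) (hc : ‖c‖ ≤ R) :
    ‖O.mkQ (a * b * c)‖ ≤ 18 * R ^ 2 * (‖O.mkQ a‖ + ‖O.mkQ b‖ + ‖O.mkQ c‖) := by
  have hR : 0 ≤ R := (norm_nonneg a).trans ha
  obtain ⟨a', ha', hda⟩ := exists_mem_norm_sub_le O hO a
  obtain ⟨b', hb', hdb⟩ := exists_mem_norm_sub_le O hO b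
  obtain ⟨c', hc', hdc⟩ := exists_mem_norm_sub_le O hO c
  have hq : ∀ x : 𝒜, ‖O.mkQ x‖ ≤ ‖x‖ := fun x => Submodule.Quotient.norm_mk_le O x
  have hn : ∀ x x' : 𝒜, ‖x‖ ≤ R → ‖x - x'‖ ≤ 2 * ‖O.mkQ x‖ → ‖x'‖ ≤ 3 * R := by
    intro x x' hx hd
    have h1 : ‖x'‖ ≤ ‖x‖ + ‖x - x'‖ := by
      have := norm_sub_le x (x - x')
      rwa [sub_sub_cancel] at this
    linarith [hq x]
  have hna := hn a a' ha hda
  have hnb := hn b b' hb hdb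
  -- Telescoping of `abc - a'b'c'`, where `a'b'c'` lies in `O`. The three terms carry `2R²`, `6R²`
  -- and `18R²`, using `‖a'‖, ‖b'‖ ≤ R + 2R`.
  have key : O.mkQ (a * b * c) =
      O.mkQ ((a - a') * b * c + a' * (b - b') * c + a' * b' * (c - c')) := by
    have h0 : O.mkQ (a' * b' * c') = 0 := by simpa using hmul a' ha' b' hb' c' hc'
    rw [← sub_eq_zero, ← map_sub, ← h0]
    congr 1
    noncomm_ring
  have m3 : ∀ x y z : 𝒜, ‖x * y * z‖ ≤ ‖x‖ * ‖y‖ * ‖z‖ := fun x y z =>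
    (norm_mul_le _ _).trans (mul_le_mul_of_nonneg_right (norm_mul_le _ _) (norm_nonneg _))
  have e1 : ‖(a - a') * b * c‖ ≤ 2 * ‖O.mkQ a‖ * R * R := (m3 _ _ _).trans (by gcongr)
  have e2 : ‖a' * (b - b') * c‖ ≤ 3 * R * (2 * ‖O.mkQ b‖) * R := (m3 _ _ _).trans (by gcongr)
  have e3 : ‖a' * b' * (c - c')‖ ≤ 3 * R * (3 * R) * (2 * ‖O.mkQ c‖) :=
    (m3 _ _ _).trans (by gcongr)
  rw [key]
  refine (hq _).trans (norm_add₃_le.trans ?_)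
  nlinarith [mul_nonneg (sq_nonneg R) (norm_nonneg (O.mkQ a)),
    mul_nonneg (sq_nonneg R) (norm_nonneg (O.mkQ b))]

end Quotient

/-! ### Regularity of solutions and their confinement to closed subspaces. -/

section Solution

variable {V 𝒜 : Type*} [NormedAddCommGroup V] [InnerProductSpace ℝ V] [CStarAlgebra 𝒜]
  {F : V →ₗ[ℝ] ExteriorAlgebra ℝ V} {B : ℝ → GrassmannVar V 𝒜} {Ψ₀ : GrassmannVar V 𝒜} {T : ℝ}
  {Ψ : ℝ → GrassmannVar V 𝒜}

theorem IsSolution.continuousOn_apply (hΨ : IsSolution F B Ψ₀ T Ψ) (G : ExteriorAlgebra ℝ V) :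
    ContinuousOn (fun t => Ψ t G) (Set.Icc 0 T) := by
  refine mul_ι_induction (P := fun G => ContinuousOn (fun t => Ψ t G) (Set.Icc 0 T)) (fun r => ?_)
    (fun x y hx hy => ?_) (fun v x hx => ?_) G
  · simp only [AlgHom.commutes]; exact continuousOn_const
  · simp only [map_add]; exact hx.add hy
  · simp only [map_mul]; exact hx.mul (hΨ.continuousOn v)

/-- `Ψ - B` is differentiable, with derivative given by the drift. -/
theorem IsSolution.hasDerivWithinAt (hΨ : IsSolution F B Ψ₀ T Ψ) (v : V) {t : ℝ}
    (ht : t ∈ Set.Ico 0 T) :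
    HasDerivWithinAt (fun s => Ψ s (ExteriorAlgebra.ι ℝ v) - B s (ExteriorAlgebra.ι ℝ v))
      (Ψ t (F v)) (Set.Ici t) t := by
  have hT : (0 : ℝ) ≤ T := ht.1.trans ht.2.le
  -- A continuous extension to all of `ℝ` lets the fundamental theorem of calculus apply at the
  -- endpoint `0` too.
  set g : ℝ → 𝒜 := Set.IccExtend hT ((Set.Icc 0 T).domRestrict fun r => Ψ r (F v))
  have hg : Continuous g := (hΨ.continuousOn_apply (F v)).domRestrict.Icc_extend'
  have hgeq : ∀ r ∈ Set.Icc 0 T, g r = Ψ r (F v) := fun r hr => Set.IccExtend_of_mem hT _ hr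
  have hder : HasDerivAt (fun s => Ψ₀ (ExteriorAlgebra.ι ℝ v) + ∫ r in (0 : ℝ)..s, g r) (g t) t :=
    (hg.integral_hasStrictDerivAt 0 t).hasDerivAt.const_add _
  have heq : ∀ s ∈ Set.Icc 0 T, Ψ s (ExteriorAlgebra.ι ℝ v) - B s (ExteriorAlgebra.ι ℝ v) =
      Ψ₀ (ExteriorAlgebra.ι ℝ v) + ∫ r in (0 : ℝ)..s, g r := by
    intro s hs
    rw [hΨ.equation s hs v, add_sub_cancel_right]
    congr 1
    refine intervalIntegral.integral_congr fun r hr => (hgeq r ?_).symm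
    rw [Set.uIcc_of_le hs.1] at hr
    exact ⟨hr.1, hr.2.trans hs.2⟩
  rw [← hgeq t ⟨ht.1, ht.2.le⟩]
  refine hder.hasDerivWithinAt.congr_of_eventuallyEq ?_ (heq t ⟨ht.1, ht.2.le⟩)
  filter_upwards [self_mem_nhdsWithin, mem_nhdsWithin_of_mem_nhds (Iio_mem_nhds ht.2)] with s h1 h2
  exact heq s ⟨ht.1.trans h1, le_of_lt h2⟩

/-- A closed subspace stable under triple products that contains the initial condition and the
noise up to time `τ` contains the solution at time `τ`, when the drift is odd. -/
theorem IsSolution.mem_of_isClosed [FiniteDimensional ℝ V] (hΨ : IsSolution F B Ψ₀ T Ψ)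
    (hF : ∀ v, F v ∈ oddPart V) {τ : ℝ} (hτ : τ ∈ Set.Icc 0 T) (O : Submodule ℝ 𝒜)
    (hO : IsClosed (O : Set 𝒜)) (hmul : ∀ a ∈ O, ∀ b ∈ O, ∀ c ∈ O, a * b * c ∈ O)
    (h0 : ∀ v, Ψ₀ (ExteriorAlgebra.ι ℝ v) ∈ O)
    (hB : ∀ s ∈ Set.Icc 0 τ, ∀ v, B s (ExteriorAlgebra.ι ℝ v) ∈ O) (v : V) :
    Ψ τ (ExteriorAlgebra.ι ℝ v) ∈ O := by
  have hO' : IsClosed (O : Set 𝒜) := hO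
  set e := stdOrthonormalBasis ℝ V
  -- Modulo `O` the noise disappears, so the classes of the solution are right differentiable and
  -- satisfy `‖u'‖ ≤ K ‖u‖` with `u 0 = 0`.
  set u : ℝ → Fin (Module.finrank ℝ V) → 𝒜 ⧸ O :=
    fun s i => O.mkQ (Ψ s (ExteriorAlgebra.ι ℝ (e i))) with hu
  have hsub : Set.Icc 0 τ ⊆ Set.Icc 0 T := Set.Icc_subset_Icc_right hτ.2
  have hbound : ∀ G : ExteriorAlgebra ℝ V, ∃ R, ∀ s ∈ Set.Icc 0 T, ‖Ψ s G‖ ≤ R := fun G =>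
    isCompact_Icc.exists_bound_of_continuousOn (hΨ.continuousOn_apply G)
  have hι : ∀ v : V, ∃ K : ℝ, 0 ≤ K ∧ ∀ s ∈ Set.Icc 0 T,
      ‖O.mkQ (Ψ s (ExteriorAlgebra.ι ℝ v))‖ ≤ K * ‖u s‖ := by
    intro v
    refine ⟨∑ i, ‖(inner ℝ (e i) v : ℝ)‖, by positivity, fun s _ => ?_⟩
    have : O.mkQ (Ψ s (ExteriorAlgebra.ι ℝ v)) = ∑ i, (inner ℝ (e i) v : ℝ) • u s i := by
      conv_lhs => rw [← e.sum_repr' v]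
      simp only [map_sum, map_smul, hu]
    rw [this, Finset.sum_mul]
    refine (norm_sum_le _ _).trans (Finset.sum_le_sum fun i _ => ?_)
    rw [norm_smul]
    exact mul_le_mul_of_nonneg_left (norm_le_pi_norm (u s) i) (norm_nonneg _)
  -- Odd words are built from single letters by triple products, for which the distance to `O` is
  -- controlled. The bound `R` comes from compactness of `[0, T]`.
  have hodd : ∀ G ∈ oddPart V, ∃ K : ℝ, 0 ≤ K ∧ ∀ s ∈ Set.Icc 0 T,
      ‖O.mkQ (Ψ s G)‖ ≤ K * ‖u s‖ := by
    intro G hG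
    refine oddPart_induction (P := fun G => ∃ K : ℝ, 0 ≤ K ∧ ∀ s ∈ Set.Icc 0 T,
      ‖O.mkQ (Ψ s G)‖ ≤ K * ‖u s‖) hι ?_ ?_ hG
    · rintro x y ⟨K, hK, hx⟩ ⟨L, hL, hy⟩
      refine ⟨K + L, by positivity, fun s hs => ?_⟩
      rw [map_add, map_add, add_mul]
      exact (norm_add_le _ _).trans (add_le_add (hx s hs) (hy s hs))
    · rintro v w x ⟨K, hK, hx⟩
      obtain ⟨Kv, hKv, hv⟩ := hι v
      obtain ⟨Kw, hKw, hw⟩ := hι w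
      obtain ⟨Rv, hRv⟩ := hbound (ExteriorAlgebra.ι ℝ v)
      obtain ⟨Rw, hRw⟩ := hbound (ExteriorAlgebra.ι ℝ w)
      obtain ⟨Rx, hRx⟩ := hbound x
      set R := max Rv (max Rw Rx)
      refine ⟨18 * R ^ 2 * (Kv + Kw + K), by positivity, fun s hs => ?_⟩
      have hprod : Ψ s (ExteriorAlgebra.ι ℝ v * ExteriorAlgebra.ι ℝ w * x) =
          Ψ s (ExteriorAlgebra.ι ℝ v) * Ψ s (ExteriorAlgebra.ι ℝ w) * Ψ s x := by
        rw [map_mul, map_mul]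
      rw [hprod]
      refine (norm_mkQ_mul_mul_le O hO hmul (R := R) ((hRv s hs).trans (le_max_left _ _))
        ((hRw s hs).trans ((le_max_left _ _).trans (le_max_right _ _)))
        ((hRx s hs).trans ((le_max_right _ _).trans (le_max_right _ _)))).trans ?_
      rw [mul_assoc _ (Kv + Kw + K), add_mul, add_mul]
      exact mul_le_mul_of_nonneg_left (add_le_add (add_le_add (hv s hs) (hw s hs)) (hx s hs))
        (by positivity)
  have hdrift : ∃ K : ℝ, 0 ≤ K ∧ ∀ s ∈ Set.Icc 0 T, ∀ i,
      ‖O.mkQ (Ψ s (F (e i)))‖ ≤ K * ‖u s‖ := by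
    choose K hK hKs using fun i => hodd (F (e i)) (hF _)
    refine ⟨∑ i, K i, Finset.sum_nonneg fun i _ => hK i, fun s hs i => (hKs i s hs).trans ?_⟩
    exact mul_le_mul_of_nonneg_right (Finset.single_le_sum (fun j _ => hK j) (Finset.mem_univ i))
      (norm_nonneg _)
  obtain ⟨K, hK0, hK⟩ := hdrift
  have hcont : ContinuousOn u (Set.Icc 0 τ) := continuousOn_pi.mpr fun i =>
    O.mkQL.continuous.comp_continuousOn ((hΨ.continuousOn (e i)).mono hsub)
  have hderiv : ∀ s ∈ Set.Ico 0 τ,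
      HasDerivWithinAt u (fun i => O.mkQ (Ψ s (F (e i)))) (Set.Ici s) s := by
    intro s hs
    refine hasDerivWithinAt_pi.mpr fun i => ?_
    have h := O.mkQL.hasFDerivAt.comp_hasDerivWithinAt s
      (hΨ.hasDerivWithinAt (e i) (t := s) ⟨hs.1, hs.2.trans_le hτ.2⟩)
    have heq : ∀ r ∈ Set.Icc 0 τ, u r i = (O.mkQL ∘ fun r => Ψ r (ExteriorAlgebra.ι ℝ (e i)) -
        B r (ExteriorAlgebra.ι ℝ (e i))) r := by
      intro r hr
      have : O.mkQ (B r (ExteriorAlgebra.ι ℝ (e i))) = 0 := by simpa using hB r hr (e i)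
      simp only [Function.comp_apply, Submodule.mkQL_apply, map_sub, this, sub_zero, hu]
    refine h.congr_of_eventuallyEq ?_ (heq s ⟨hs.1, hs.2.le⟩)
    filter_upwards [self_mem_nhdsWithin, mem_nhdsWithin_of_mem_nhds (Iio_mem_nhds hs.2)]
      with r h1 h2
    exact heq r ⟨hs.1.trans h1, le_of_lt h2⟩
  have hzero : ∀ s ∈ Set.Icc 0 τ, u s = 0 := by
    intro s hs
    have hinit : u 0 = 0 := by
      funext i
      have h0mem : (0 : ℝ) ∈ Set.Icc 0 T := ⟨le_rfl, hτ.1.trans hτ.2⟩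
      have : Ψ 0 (ExteriorAlgebra.ι ℝ (e i)) ∈ O := by
        rw [hΨ.equation 0 h0mem, intervalIntegral.integral_same, add_zero]
        exact add_mem (h0 _) (hB 0 ⟨le_rfl, hτ.1⟩ _)
      simpa [hu] using this
    have := norm_le_gronwallBound_of_norm_deriv_right_le (δ := 0) (K := K) (ε := 0) hcont hderiv
      (by rw [hinit, norm_zero]) (fun r hr => ?_) s hs
    · rw [gronwallBound_ε0_δ0] at this
      exact norm_le_zero_iff.mp this
    · rw [add_zero]
      have hrT : r ∈ Set.Icc 0 T := hsub ⟨hr.1, hr.2.le⟩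
      exact (pi_norm_le_iff_of_nonneg (mul_nonneg hK0 (norm_nonneg _))).mpr (hK r hrT)
  obtain ⟨Kv, -, hv⟩ := hι v
  have := hv τ hτ
  rw [hzero τ ⟨hτ.1, le_rfl⟩, norm_zero, mul_zero] at this
  simpa using norm_le_zero_iff.mp this

end Solution

/-! ### Inner products of noise vectors in `L²(ℝ; V)`. -/

section NoiseVector

variable {V : Type*} [NormedAddCommGroup V] [InnerProductSpace ℝ V]

/-- The vector `𝟙_[0,t] ⊗ v` of `L²(ℝ; V)`. -/
def noiseVec (t : ℝ) (v : V) : Lp V 2 (volume : Measure ℝ) :=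
  indicatorConstLp 2 (measurableSet_Icc (a := (0 : ℝ)) (b := t)) measure_Icc_lt_top.ne v

theorem inner_noiseVec [CompleteSpace V] {s t : ℝ} (hs : 0 ≤ s) (hst : s ≤ t) (v w : V) :
    (inner ℝ (noiseVec s v) (noiseVec t w) : ℝ) = s * inner ℝ v w := by
  rw [noiseVec, noiseVec, L2.inner_indicatorConstLp_indicatorConstLp _ _ measure_Icc_lt_top.ne
    measure_Icc_lt_top.ne,
    Set.Icc_inter_Icc, sup_idem, inf_eq_left.mpr hst, Real.volume_real_Icc_of_le hs, sub_zero,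
    smul_eq_mul]

theorem inner_noiseVec_sub [CompleteSpace V] {s t h : ℝ} (hs : 0 ≤ s) (hst : s ≤ t) (hh : 0 ≤ h)
    (v w : V) :
    (inner ℝ (noiseVec s v) (noiseVec (t + h) w - noiseVec t w) : ℝ) = 0 := by
  rw [inner_sub_right, inner_noiseVec hs (by linarith), inner_noiseVec hs hst, sub_self]

theorem inner_noiseVec_sub_sub [CompleteSpace V] {t h : ℝ} (ht : 0 ≤ t) (hh : 0 ≤ h) (v w : V) :
    (inner ℝ (noiseVec (t + h) v - noiseVec t v) (noiseVec (t + h) w - noiseVec t w) : ℝ) =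
      h * inner ℝ v w := by
  rw [inner_sub_left, inner_noiseVec_sub ht le_rfl hh, sub_zero, inner_sub_right,
    inner_noiseVec (by linarith) le_rfl, real_inner_comm (noiseVec t w) (noiseVec (t + h) v),
    inner_noiseVec ht (by linarith), real_inner_comm v w]
  ring

theorem norm_noiseVec_sub [CompleteSpace V] {t h : ℝ} (ht : 0 ≤ t) (hh : 0 ≤ h) (v : V) :
    ‖noiseVec (t + h) v - noiseVec t v‖ = Real.sqrt h * ‖v‖ := by
  rw [norm_eq_sqrt_real_inner, inner_noiseVec_sub_sub ht hh, Real.sqrt_mul hh,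
    ← norm_eq_sqrt_real_inner]

theorem compLpL_noiseVec (C : V →L[ℝ] V) (t : ℝ) (v : V) :
    C.compLpL 2 (volume : Measure ℝ) (noiseVec t v) = noiseVec t (C v) := by
  ext1
  refine (C.coeFn_compLpL _).trans ?_
  have h1 : noiseVec t v =ᵐ[volume] (Set.Icc 0 t).indicator fun _ => v := indicatorConstLp_coeFn
  have h2 : noiseVec t (C v) =ᵐ[volume] (Set.Icc 0 t).indicator fun _ => C v :=
    indicatorConstLp_coeFn
  filter_upwards [h1, h2] with x hx1 hx2
  rw [hx1, hx2]
  by_cases hx : x ∈ Set.Icc 0 t <;> simp [hx]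

theorem noiseVec_zero_time [CompleteSpace V] (v : V) : noiseVec 0 v = 0 := by
  rw [← inner_self_eq_zero (𝕜 := ℝ), inner_noiseVec le_rfl le_rfl, zero_mul]

end NoiseVector

/-! ### Independence from the noise and the algebra of the past. -/

section Independence

variable {V W 𝒜 : Type*} [AddCommGroup V] [Module ℝ V] [AddCommGroup W] [Module ℝ W]
  [CStarAlgebra 𝒜]

theorem anticommute (X : GrassmannVar V 𝒜) (v w : V) :
    X (ExteriorAlgebra.ι ℝ v) * X (ExteriorAlgebra.ι ℝ w) =
      -(X (ExteriorAlgebra.ι ℝ w) * X (ExteriorAlgebra.ι ℝ v)) := by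
  rw [← map_mul, ι_mul_ι_swap, map_neg, map_mul]

theorem IsIndependentOfProcess.anticommute {ω : 𝒜 →L[ℂ] ℂ} {X : GrassmannVar W 𝒜}
    {B : ℝ → GrassmannVar V 𝒜} (h : IsIndependentOfProcess ω X B) {t : ℝ} (ht : 0 ≤ t)
    (w : W) (v : V) :
    X (ExteriorAlgebra.ι ℝ w) * B t (ExteriorAlgebra.ι ℝ v) =
      -(B t (ExteriorAlgebra.ι ℝ v) * X (ExteriorAlgebra.ι ℝ w)) := by
  obtain ⟨Y, hY, ⟨Z, hZ1, hZ2⟩, -⟩ := h 1 (fun _ => t) (fun _ => ht)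
  rw [← hY 0 v, ← hZ1, ← hZ2]
  exact GrassmannSDE.anticommute Z _ _

/-- The algebra generated by a process. -/
def processAlgebra (B : ℝ → GrassmannVar V 𝒜) : Subalgebra ℝ 𝒜 :=
  Algebra.adjoin ℝ {a | ∃ s : ℝ, 0 ≤ s ∧ ∃ v : V, a = B s (ExteriorAlgebra.ι ℝ v)}

/-- By linearity `a` is a word in the process. It involves finitely many times, so it is the image
of one product under a joint variable, with a separate copy of `V` for each letter. -/
theorem IsIndependentOfProcess.map_mul {ω : 𝒜 →L[ℂ] ℂ} {X : GrassmannVar W 𝒜}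
    {B : ℝ → GrassmannVar V 𝒜} (h : IsIndependentOfProcess ω X B) (P : ExteriorAlgebra ℝ W)
    {a : 𝒜} (ha : a ∈ processAlgebra B) : ω (X P * a) = ω (X P) * ω a := by
  rw [processAlgebra, ← Subalgebra.mem_toSubmodule, Algebra.adjoin_eq_span] at ha
  induction ha using Submodule.span_induction with
  | zero => simp
  | add x y _ _ hx hy => rw [mul_add, map_add, map_add, hx, hy, mul_add]
  | smul r x _ hx => rw [mul_smul_comm, map_real_smul, map_real_smul, hx, mul_smul_comm]
  | mem x hx =>
    obtain ⟨l, hl, rfl⟩ := Submonoid.exists_list_of_mem_closure hx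
    choose s hs v hv using fun i : Fin l.length => hl (l.get i) (l.get_mem i)
    obtain ⟨Y, hY, -, hind⟩ := h l.length s hs
    have hprod : Y (List.ofFn fun i => ExteriorAlgebra.ι ℝ (Pi.single i (v i))).prod = l.prod := by
      rw [map_list_prod, List.map_ofFn]
      congr 1
      conv_rhs => rw [← List.ofFn_get l]
      congr 1
      funext i
      rw [Function.comp_apply, hY, ← hv]
    rw [← hprod]
    exact hind P _

/-- The initial condition and the noise up to time `t`. -/
def pastGenerators (X : GrassmannVar W 𝒜) (B : ℝ → GrassmannVar V 𝒜) (t : ℝ) : Set 𝒜 :=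
  {a | ∃ w : W, a = X (ExteriorAlgebra.ι ℝ w)} ∪
    {a | ∃ s ∈ Set.Icc 0 t, ∃ v : V, a = B s (ExteriorAlgebra.ι ℝ v)}

/-- The closed algebra of the past up to time `t`, generated by the initial condition and the
noise up to time `t`. -/
def past (X : GrassmannVar W 𝒜) (B : ℝ → GrassmannVar V 𝒜) (t : ℝ) : Subalgebra ℝ 𝒜 :=
  (Algebra.adjoin ℝ (pastGenerators X B t)).topologicalClosure

theorem isClosed_past (X : GrassmannVar W 𝒜) (B : ℝ → GrassmannVar V 𝒜) (t : ℝ) :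
    IsClosed (past X B t : Set 𝒜) :=
  Subalgebra.isClosed_topologicalClosure _

theorem ι_mem_past (X : GrassmannVar W 𝒜) (B : ℝ → GrassmannVar V 𝒜) (t : ℝ) (w : W) :
    X (ExteriorAlgebra.ι ℝ w) ∈ past X B t :=
  Subalgebra.le_topologicalClosure _ (Algebra.subset_adjoin (Or.inl ⟨w, rfl⟩))

theorem process_mem_past (X : GrassmannVar W 𝒜) (B : ℝ → GrassmannVar V 𝒜) {s t : ℝ}
    (hs : s ∈ Set.Icc 0 t) (v : V) : B s (ExteriorAlgebra.ι ℝ v) ∈ past X B t :=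
  Subalgebra.le_topologicalClosure _ (Algebra.subset_adjoin (Or.inr ⟨s, hs, v, rfl⟩))

theorem apply_mem_of_ι_mem (X : GrassmannVar V 𝒜) (S : Subalgebra ℝ 𝒜)
    (h : ∀ v, X (ExteriorAlgebra.ι ℝ v) ∈ S) (G : ExteriorAlgebra ℝ V) : X G ∈ S := by
  refine mul_ι_induction (P := fun G => X G ∈ S) (fun r => ?_) (fun x y hx hy => ?_)
    (fun v x hx => ?_) G
  · rw [AlgHom.commutes]; exact S.algebraMap_mem r
  · rw [map_add]; exact add_mem hx hy
  · rw [_root_.map_mul]; exact mul_mem hx (h v)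

end Independence

/-! ### Brownian increments conditioned on the past. -/

section Brownian

variable {V W 𝒜 : Type*} [NormedAddCommGroup V] [InnerProductSpace ℝ V]
  [AddCommGroup W] [Module ℝ W]
  [CStarAlgebra 𝒜] {ω : 𝒜 →L[ℂ] ℂ} {X : GrassmannVar W 𝒜} {B : ℝ → GrassmannVar V 𝒜}
  {C : V →L[ℝ] V}

/-- The increment `B_{t+h}(v) - B_t(v)`. -/
def increment (B : ℝ → GrassmannVar V 𝒜) (t h : ℝ) (v : V) : 𝒜 :=
  B (t + h) (ExteriorAlgebra.ι ℝ v) - B t (ExteriorAlgebra.ι ℝ v)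

theorem IsBrownianMotion.anticommute (hB : IsBrownianMotion ω B C) {s t : ℝ} (hs : 0 ≤ s)
    (ht : 0 ≤ t) (v w : V) :
    B s (ExteriorAlgebra.ι ℝ v) * B t (ExteriorAlgebra.ι ℝ w) =
      -(B t (ExteriorAlgebra.ι ℝ w) * B s (ExteriorAlgebra.ι ℝ v)) := by
  obtain ⟨Ξ, -, hΞ⟩ := hB
  rw [hΞ s hs, hΞ t ht]
  exact GrassmannSDE.anticommute Ξ _ _

theorem IsBrownianMotion.apply_zero [CompleteSpace V] (hB : IsBrownianMotion ω B C) (v : V) :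
    B 0 (ExteriorAlgebra.ι ℝ v) = 0 := by
  obtain ⟨Ξ, -, hΞ⟩ := hB
  rw [hΞ 0 le_rfl]
  change Ξ (ExteriorAlgebra.ι ℝ (noiseVec 0 v)) = 0
  rw [noiseVec_zero_time, map_zero, map_zero]

/-- The white noise is a bounded operator on `L²`, and the increment of the noise vector has norm
`√h ‖v‖`. -/
theorem IsBrownianMotion.exists_norm_increment_le [CompleteSpace V] (hB : IsBrownianMotion ω B C) :
    ∃ K : ℝ, 0 ≤ K ∧ ∀ t h : ℝ, 0 ≤ t → 0 ≤ h → ∀ v : V,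
      ‖increment B t h v‖ ≤ K * (Real.sqrt h * ‖v‖) := by
  obtain ⟨Ξ, hG, hΞ⟩ := hB
  set L : Lp V 2 (volume : Measure ℝ) →L[ℝ] 𝒜 :=
    ⟨Ξ.toLinearMap ∘ₗ ExteriorAlgebra.ι ℝ, hG.continuous⟩
  refine ⟨‖L‖, L.opNorm_nonneg, fun t h ht hh v => ?_⟩
  have : increment B t h v = L (noiseVec (t + h) v - noiseVec t v) := by
    rw [increment, hΞ t ht, hΞ (t + h) (by linarith), map_sub]
    rfl
  rw [this, ← norm_noiseVec_sub ht hh]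
  exact L.le_opNorm _

theorem rightDeriv_eq_zero_of_mem_closure {H : Type*} [NormedAddCommGroup H]
    [InnerProductSpace ℝ H] {S : Set H} {g : H} (hS : ∀ f ∈ S, (inner ℝ f g : ℝ) = 0)
    {q : ExteriorAlgebra ℝ H} (hq : q ∈ Submonoid.closure (ExteriorAlgebra.ι ℝ '' S)) :
    rightDeriv q g = 0 := by
  induction hq using Submonoid.closure_induction_right with
  | one => exact rightDeriv_one g
  | mul_right x hx y hy ih =>
    obtain ⟨f, hf, rfl⟩ := hy
    rw [rightDeriv_mul_ι, ih, hS f hf, zero_smul, zero_mul, sub_zero]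

/-- The increments of the noise after time `t` are centered with covariance `h ⟨v, C w⟩`,
conditionally on the past. -/
theorem IsBrownianMotion.increment_past [CompleteSpace V] (hB : IsBrownianMotion ω B C)
    (hX : IsIndependentOfProcess ω X B) {t h : ℝ} (ht : 0 ≤ t) (hh : 0 ≤ h) (v w : V) {K : 𝒜}
    (hK : K ∈ past X B t) :
    ω (K * increment B t h v) = 0 ∧
    ω (K * (increment B t h v * increment B t h w)) = (h * inner ℝ v (C w) : ℝ) • ω K := by
  have hXB := fun (s : ℝ) (hs : 0 ≤ s) => hX.anticommute hs
  have hth : 0 ≤ t + h := by linarith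
  have hmemB : ∀ s : ℝ, 0 ≤ s → ∀ v : V, B s (ExteriorAlgebra.ι ℝ v) ∈ processAlgebra B :=
    fun s hs v => Algebra.subset_adjoin ⟨s, hs, v, rfl⟩
  have hmemI : ∀ v : V, increment B t h v ∈ processAlgebra B := fun v =>
    sub_mem (hmemB _ hth v) (hmemB _ ht v)
  obtain ⟨Ξ, hG, hΞ⟩ := hB
  have hΞ' : ∀ s : ℝ, 0 ≤ s → ∀ v : V,
      B s (ExteriorAlgebra.ι ℝ v) = Ξ (ExteriorAlgebra.ι ℝ (noiseVec s v)) := hΞ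
  have hinc : ∀ v : V, increment B t h v =
      Ξ (ExteriorAlgebra.ι ℝ (noiseVec (t + h) v - noiseVec t v)) := fun v => by
    rw [increment, hΞ' t ht, hΞ' (t + h) hth, map_sub, map_sub]
  have hCinc : ∀ v : V, C.compLpL 2 (volume : Measure ℝ) (noiseVec (t + h) v - noiseVec t v) =
      noiseVec (t + h) (C v) - noiseVec t (C v) := fun v => by
    rw [map_sub, compLpL_noiseVec, compLpL_noiseVec]
  set S : Set (Lp V 2 (volume : Measure ℝ)) := {f | ∃ s ∈ Set.Icc 0 t, ∃ v : V, f = noiseVec s v}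
  have hder : ∀ q ∈ Submonoid.closure (ExteriorAlgebra.ι ℝ '' S), ∀ w : V,
      rightDeriv q (noiseVec (t + h) w - noiseVec t w) = 0 := by
    intro q hq w
    refine rightDeriv_eq_zero_of_mem_closure ?_ hq
    rintro f ⟨s, hs, v, rfl⟩
    exact inner_noiseVec_sub hs.1 hs.2 hh v w
  have hqmem : ∀ q ∈ Submonoid.closure (ExteriorAlgebra.ι ℝ '' S), Ξ q ∈ processAlgebra B := by
    intro q hq
    induction hq using Submonoid.closure_induction with
    | one => rw [map_one]; exact one_mem _
    | mul x y _ _ hx hy => rw [_root_.map_mul]; exact mul_mem hx hy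
    | mem x hx =>
      obtain ⟨f, ⟨s, hs, v, rfl⟩, rfl⟩ := hx
      rw [← hΞ' s hs.1]
      exact hmemB s hs.1 v
  -- Every word of the past factors as initial condition times noise: a noise letter moves to the
  -- right of `X P` at the cost of the grade involution of `P`.
  have hword : ∀ x ∈ Submonoid.closure (pastGenerators X B t),
      ∃ P, ∃ q ∈ Submonoid.closure (ExteriorAlgebra.ι ℝ '' S), x = X P * Ξ q := by
    intro x hx
    induction hx using Submonoid.closure_induction_left with
    | one => exact ⟨1, 1, one_mem _, by simp⟩
    | mul_left x hx y _ ih =>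
      obtain ⟨P, q, hq, rfl⟩ := ih
      rcases hx with ⟨w, rfl⟩ | ⟨s, hs, v, rfl⟩
      · exact ⟨ExteriorAlgebra.ι ℝ w * P, q, hq, by rw [_root_.map_mul, mul_assoc]⟩
      · refine ⟨CliffordAlgebra.involute (Q := (0 : QuadraticForm ℝ W)) P,
          ExteriorAlgebra.ι ℝ (noiseVec s v) * q,
          mul_mem (Submonoid.subset_closure ⟨_, ⟨s, hs, v, rfl⟩, rfl⟩) hq, ?_⟩
        rw [← mul_assoc, involute_swap X (fun w => hXB s hs.1 w v), mul_assoc, hΞ' s hs.1,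
          ← _root_.map_mul Ξ]
  have hadj : ∀ K ∈ Algebra.adjoin ℝ (pastGenerators X B t),
      ω (K * increment B t h v) = 0 ∧
      ω (K * (increment B t h v * increment B t h w)) = (h * inner ℝ v (C w) : ℝ) • ω K := by
    intro K hK
    rw [← Subalgebra.mem_toSubmodule, Algebra.adjoin_eq_span] at hK
    induction hK using Submodule.span_induction with
    | zero => simp
    | add x y _ _ hx hy =>
      simp only [add_mul, map_add, hx.1, hx.2, hy.1, hy.2, smul_add, add_zero, and_self]
    | smul r x _ hx =>
      simp only [smul_mul_assoc, map_real_smul, hx.1, hx.2, smul_zero, true_and]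
      exact smul_comm _ _ _
    | mem x hx =>
      obtain ⟨P, q, hq, rfl⟩ := hword x hx
      rw [mul_assoc, mul_assoc, hX.map_mul P (mul_mem (hqmem q hq) (hmemI v)),
        hX.map_mul P (mul_mem (hqmem q hq) (mul_mem (hmemI v) (hmemI w))),
        hX.map_mul P (hqmem q hq)]
      constructor
      -- Past noise is orthogonal in `L²` to the increment, so every contraction vanishes. For two
      -- increments, below, only their mutual contraction survives.
      · rw [hinc v, hG.integration_by_parts, hCinc, hder q hq, map_zero, map_zero, mul_zero]
      · rw [hinc v, hinc w, ← mul_assoc, ← _root_.map_mul Ξ, hG.integration_by_parts, hCinc,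
          rightDeriv_mul_ι, hder q hq, zero_mul, sub_zero, inner_noiseVec_sub_sub ht hh, map_smul,
          map_real_smul, mul_smul_comm]
  -- Both identities are closed conditions on `K`, so they pass to the closure of the algebra.
  have hcl1 : IsClosed {K : 𝒜 | ω (K * increment B t h v) = 0} :=
    isClosed_eq (by fun_prop) continuous_const
  have hcl2 : IsClosed {K : 𝒜 | ω (K * (increment B t h v * increment B t h w)) =
      (h * inner ℝ v (C w) : ℝ) • ω K} :=
    isClosed_eq (by fun_prop) (by fun_prop)
  have hK' : K ∈ closure (Algebra.adjoin ℝ (pastGenerators X B t) : Set 𝒜) := by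
    rw [← Subalgebra.topologicalClosure_coe]; exact hK
  exact closure_minimal (s := (Algebra.adjoin ℝ (pastGenerators X B t) : Set 𝒜))
    (fun K hK => hadj K hK)
    (hcl1.inter hcl2) hK'

end Brownian

/-! ### Itô expansion to first order in the time step. -/

section Expansion

open Asymptotics Filter Topology

variable {V 𝒜 : Type*} [NormedAddCommGroup V] [InnerProductSpace ℝ V] [CStarAlgebra 𝒜]

/-- The Grassmann variables `Y h` expand, as `h → 0⁺`, around `X` with drift `F` and with centered
noise `β h` of covariance `h C`, where the noise is independent of the present `X` and of the
weight `E`. -/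
structure IsItoExpansion (ω : 𝒜 →L[ℂ] ℂ) (F : V →ₗ[ℝ] ExteriorAlgebra ℝ V) (C : V →L[ℝ] V)
    (X : GrassmannVar V 𝒜) (Y : ℝ → GrassmannVar V 𝒜) (β : ℝ → V → 𝒜) (E : 𝒜) : Prop where
  expansion : ∀ v, (fun h => Y h (ExteriorAlgebra.ι ℝ v) - X (ExteriorAlgebra.ι ℝ v) -
    h • X (F v) - β h v) =o[𝓝[>] 0] fun h => h
  noise_isBigO : ∀ v, (fun h => β h v) =O[𝓝[>] 0] Real.sqrt
  noise_anticommute : ∀ h > 0, ∀ v w,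
    X (ExteriorAlgebra.ι ℝ v) * β h w = -(β h w * X (ExteriorAlgebra.ι ℝ v))
  noise_commute : ∀ h > 0, ∀ v, Commute E (β h v)
  mean : ∀ h > 0, ∀ G v, ω (X G * E * β h v) = 0
  cov : ∀ h > 0, ∀ G v w, ω (X G * E * (β h v * β h w)) = (h * inner ℝ v (C w)) • ω (X G * E)

namespace IsItoExpansion

variable {ω : 𝒜 →L[ℂ] ℂ} {F : V →ₗ[ℝ] ExteriorAlgebra ℝ V} {C : V →L[ℝ] V}
  {X : GrassmannVar V 𝒜} {Y : ℝ → GrassmannVar V 𝒜} {β : ℝ → V → 𝒜} {E : 𝒜}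

theorem isBigO_id_sqrt : (fun h : ℝ => h) =O[𝓝[>] 0] Real.sqrt := by
  have hlt : ∀ᶠ h : ℝ in 𝓝[>] 0, h < 1 := mem_nhdsWithin_of_mem_nhds (Iio_mem_nhds one_pos)
  refine IsBigO.of_bound 1 ?_
  filter_upwards [self_mem_nhdsWithin, hlt] with h h0 h1
  have h0' : (0 : ℝ) < h := h0
  rw [Real.norm_of_nonneg h0'.le, Real.norm_of_nonneg (Real.sqrt_nonneg h), one_mul]
  exact Real.le_sqrt_of_sq_le (by nlinarith)

theorem isLittleO_sqrt_one : Real.sqrt =o[𝓝[>] 0] fun _ => (1 : ℝ) := by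
  rw [isLittleO_one_iff]
  have := (Real.continuous_sqrt.tendsto 0).mono_left (nhdsWithin_le_nhds (s := Set.Ioi 0))
  rwa [Real.sqrt_zero] at this

theorem isLittleO_mul_sqrt : (fun h : ℝ => h * Real.sqrt h) =o[𝓝[>] 0] fun h => h := by
  simpa using (isBigO_refl (fun h : ℝ => h) (𝓝[>] 0)).mul_isLittleO isLittleO_sqrt_one

theorem isLittleO_sqrt_mul_sqrt_mul_sqrt :
    (fun h : ℝ => Real.sqrt h * Real.sqrt h * Real.sqrt h) =o[𝓝[>] 0] fun h => h := by
  refine isLittleO_mul_sqrt.congr' ?_ EventuallyEq.rfl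
  filter_upwards [self_mem_nhdsWithin] with h h0
  rw [Real.mul_self_sqrt (le_of_lt h0)]

theorem ι_sub_sub_isBigO (hI : IsItoExpansion ω F C X Y β E) (v : V) :
    (fun h => Y h (ExteriorAlgebra.ι ℝ v) - X (ExteriorAlgebra.ι ℝ v) - β h v)
      =O[𝓝[>] 0] fun h => h := by
  have h2 : (fun h : ℝ => h • X (F v)) =O[𝓝[>] 0] fun h => h := by
    simpa using (isBigO_refl (fun h : ℝ => h) (𝓝[>] 0)).smul (isBigO_const_const (X (F v))
      (one_ne_zero (α := ℝ)) (𝓝[>] (0 : ℝ)))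
  refine ((hI.expansion v).isBigO.add h2).congr_left fun h => ?_
  abel

theorem ι_sub_isBigO (hI : IsItoExpansion ω F C X Y β E) (v : V) :
    (fun h => Y h (ExteriorAlgebra.ι ℝ v) - X (ExteriorAlgebra.ι ℝ v))
      =O[𝓝[>] 0] Real.sqrt := by
  refine (((hI.ι_sub_sub_isBigO v).trans isBigO_id_sqrt).add (hI.noise_isBigO v)).congr_left
    fun h => ?_
  abel

theorem isBigO_const (a : 𝒜) : (fun _ : ℝ => a) =O[𝓝[>] 0] fun _ => (1 : ℝ) :=
  isBigO_const_const a one_ne_zero _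

theorem sub_isBigO (hI : IsItoExpansion ω F C X Y β E) (G : ExteriorAlgebra ℝ V) :
    (fun h => Y h G - X G) =O[𝓝[>] 0] Real.sqrt := by
  refine mul_ι_induction (P := fun G => (fun h => Y h G - X G) =O[𝓝[>] 0] Real.sqrt)
    (fun r => ?_) (fun x y hx hy => ?_) (fun v x hx => ?_) G
  · simp only [AlgHom.commutes, sub_self]; exact isBigO_zero _ _
  · refine (hx.add hy).congr_left fun h => ?_
    rw [map_add, map_add]; abel
  · have hY : (fun h => Y h x) =O[𝓝[>] 0] fun _ => (1 : ℝ) :=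
      ((hx.trans isLittleO_sqrt_one.isBigO).add (isBigO_const (X x))).congr_left fun h => by abel
    have h1 := hY.mul (hI.ι_sub_isBigO v)
    have h2 := hx.mul (isBigO_const (X (ExteriorAlgebra.ι ℝ v)))
    simp only [one_mul, mul_one] at h1 h2
    refine (h1.add h2).congr_left fun h => ?_
    rw [map_mul, map_mul]; noncomm_ring

theorem isBigO_one (hI : IsItoExpansion ω F C X Y β E) (G : ExteriorAlgebra ℝ V) :
    (fun h => Y h G) =O[𝓝[>] 0] fun _ => (1 : ℝ) :=
  (((hI.sub_isBigO G).trans isLittleO_sqrt_one.isBigO).add (isBigO_const (X G))).congr_left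
    fun h => by abel

theorem state_isLittleO (ω : 𝒜 →L[ℂ] ℂ) {f : ℝ → 𝒜} {g : ℝ → ℝ} (hf : f =O[𝓝[>] 0] g)
    (hg : g =o[𝓝[>] 0] fun h : ℝ => h) : (fun h => ω (f h)) =o[𝓝[>] 0] fun h : ℝ => h :=
  ((ω.isBigO_comp f _).trans hf).trans_isLittleO hg

theorem noise_mul_apply (hI : IsItoExpansion ω F C X Y β E) {h : ℝ} (hh : 0 < h) (v : V)
    (H : ExteriorAlgebra ℝ V) : β h v * (X H * E) =
      X (CliffordAlgebra.involute (Q := (0 : QuadraticForm ℝ V)) H) * E * β h v := by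
  rw [← mul_assoc, involute_swap X (fun w => hI.noise_anticommute h hh w v), mul_assoc,
    ← (hI.noise_commute h hh v).eq, mul_assoc]

theorem noise_noise_mul_apply (hI : IsItoExpansion ω F C X Y β E) {h : ℝ} (hh : 0 < h) (v w : V)
    (H : ExteriorAlgebra ℝ V) : β h v * (β h w * (X H * E)) =
      X H * E * (β h v * β h w) := by
  have hinv : CliffordAlgebra.involute (Q := (0 : QuadraticForm ℝ V))
    (CliffordAlgebra.involute (Q := (0 : QuadraticForm ℝ V)) H) = H :=
    CliffordAlgebra.involute_involute H
  rw [hI.noise_mul_apply hh, ← mul_assoc (β h v), hI.noise_mul_apply hh, hinv, mul_assoc]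

/-- First order expansion against one noise factor. -/
theorem state_mul_noise (hI : IsItoExpansion ω F C X Y β E) (G : ExteriorAlgebra ℝ V) (v : V)
    (H : ExteriorAlgebra ℝ V) :
    (fun h => ω (Y h G * (β h v * (X H * E))) -
      h • ω (X (rightDeriv G (C v)) * (X H * E))) =o[𝓝[>] 0] fun h => h := by
  -- The induction peels letters off the right end of `G` and pushes them into `H`, so `H` must stay
  -- general.
  revert H
  refine mul_ι_induction (P := fun G => ∀ H, (fun h => ω (Y h G * (β h v * (X H * E))) -
      h • ω (X (rightDeriv G (C v)) * (X H * E))) =o[𝓝[>] 0] fun h => h)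
    (fun r H => ?_) (fun x y hx hy H => ?_) (fun w x hx H => ?_) G
  · refine (isLittleO_zero _ _).congr' ?_ EventuallyEq.rfl
    filter_upwards [self_mem_nhdsWithin] with h h0
    rw [rightDeriv_algebraMap, map_zero, zero_mul, map_zero, smul_zero, sub_zero, AlgHom.commutes,
      ← Algebra.smul_def, map_real_smul, hI.noise_mul_apply h0, hI.mean h h0, smul_zero]
  · refine ((hx H).add (hy H)).congr_left fun h => ?_
    rw [rightDeriv_add, map_add, map_add, add_mul, add_mul, map_add, map_add, smul_add]
    abel
  -- Replacing the last letter by `X w + β w` costs `O(h √h)`, and replacing `Y x` by `X x` next to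
  -- two noises costs `O(h^{3/2})`. What remains is the covariance term and, after one
  -- anticommutation, the induction hypothesis for `w H`.
  · have e1 : (fun h => ω (Y h x * ((Y h (ExteriorAlgebra.ι ℝ w) - X (ExteriorAlgebra.ι ℝ w) -
        β h w) * β h v * (X H * E)))) =o[𝓝[>] 0] fun h => h := by
      have := (hI.isBigO_one x).mul (((hI.ι_sub_sub_isBigO w).mul (hI.noise_isBigO v)).mul
        (isBigO_const (X H * E)))
      simp only [one_mul, mul_one] at this
      exact state_isLittleO ω this isLittleO_mul_sqrt
    have e2 : (fun h => ω ((Y h x - X x) * β h w * β h v * (X H * E))) =o[𝓝[>] 0]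
        fun h => h := by
      have := (((hI.sub_isBigO x).mul (hI.noise_isBigO w)).mul (hI.noise_isBigO v)).mul
        (isBigO_const (X H * E))
      simp only [mul_one] at this
      exact state_isLittleO ω this isLittleO_sqrt_mul_sqrt_mul_sqrt
    refine ((e1.add e2).sub (hx (ExteriorAlgebra.ι ℝ w * H))).congr' ?_ EventuallyEq.rfl
    filter_upwards [self_mem_nhdsWithin] with h h0
    have h0' : 0 < h := h0
    have hcov : ω (X x * (β h w * (β h v * (X H * E)))) =
        (h * inner ℝ w (C v) : ℝ) • ω (X x * (X H * E)) := by
      have hXE : X x * (X H * E) = X (x * H) * E := by rw [map_mul, mul_assoc]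
      rw [hI.noise_noise_mul_apply h0', ← mul_assoc (X x) (X H * E), hXE, hI.cov h h0']
    have hsw : β h v * (X (ExteriorAlgebra.ι ℝ w * H) * E) =
        -(X (ExteriorAlgebra.ι ℝ w) * (β h v * (X H * E))) := by
      rw [map_mul, ← mul_assoc, ← mul_assoc, ← mul_assoc, hI.noise_anticommute h h0' w v]
      noncomm_ring
    have hder : ω (X (rightDeriv (x * ExteriorAlgebra.ι ℝ w) (C v)) * (X H * E)) =
        (inner ℝ w (C v) : ℝ) • ω (X x * (X H * E)) -
          ω (X (rightDeriv x (C v)) * (X (ExteriorAlgebra.ι ℝ w * H) * E)) := by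
      rw [rightDeriv_mul_ι, map_sub, map_smul, sub_mul, map_sub, smul_mul_assoc, map_real_smul]
      simp only [map_mul, mul_assoc]
    rw [hder, hsw, smul_sub, smul_smul, ← hcov, map_mul (Y h)]
    simp only [mul_sub, sub_mul, mul_neg, map_sub, map_neg, mul_assoc]
    abel

/-- Second order (Itô) expansion of `ω(Y_h(G) X(H) E)`. -/
theorem state_expansion [FiniteDimensional ℝ V] (hI : IsItoExpansion ω F C X Y β E)
    (hF : ∀ v, F v ∈ oddPart V) (hC : ∀ v w : V, inner ℝ (C v) w = -inner ℝ v (C w))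
    (G H : ExteriorAlgebra ℝ V) :
    (fun h => ω (Y h G * (X H * E)) - ω (X G * (X H * E)) -
      h • ω (X (generator F C G) * (X H * E))) =o[𝓝[>] 0] fun h => h := by
  revert H
  refine mul_ι_induction (P := fun G => ∀ H, (fun h => ω (Y h G * (X H * E)) -
      ω (X G * (X H * E)) - h • ω (X (generator F C G) * (X H * E))) =o[𝓝[>] 0] fun h => h)
    (fun r H => ?_) (fun x y hx hy H => ?_) (fun v x hx H => ?_) G
  · simp only [AlgHom.commutes, generator_algebraMap, map_zero, zero_mul, smul_zero, sub_self]
    exact isLittleO_zero _ _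
  · refine ((hx H).add (hy H)).congr_left fun h => ?_
    simp only [map_add, add_mul, smul_add]
    abel
  -- The last letter expands as `X v + h X(F v) + β v + o(h)`. These give the induction hypothesis
  -- for `v H`, the drift term, and the bracket from `state_mul_noise`: the three terms of
  -- `generator_mul_ι`.
  · have e1 : (fun h => ω (Y h x * (Y h (ExteriorAlgebra.ι ℝ v) - X (ExteriorAlgebra.ι ℝ v) -
        h • X (F v) - β h v) * (X H * E))) =o[𝓝[>] 0] fun h => h := by
      have := ((hI.isBigO_one x).mul_isLittleO (hI.expansion v)).mul_isBigO
        (isBigO_const (X H * E))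
      simp only [one_mul, mul_one] at this
      exact (ω.isBigO_comp _ _).trans_isLittleO this
    have e2 : (fun h => ω (h • ((Y h x - X x) * (X (F v) * (X H * E))))) =o[𝓝[>] 0]
        fun h => h := by
      have := (isBigO_refl (fun h : ℝ => h) (𝓝[>] 0)).smul
        ((hI.sub_isBigO x).mul (isBigO_const (X (F v) * (X H * E))))
      simp only [mul_one, smul_eq_mul] at this
      exact state_isLittleO ω this isLittleO_mul_sqrt
    refine (((e1.add e2).add (hx (ExteriorAlgebra.ι ℝ v * H))).add
      (hI.state_mul_noise x v H)).congr_left fun h => ?_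
    rw [generator_mul_ι F hF C hC]
    simp only [map_add, map_mul, mul_sub, sub_mul, add_mul, map_sub, map_real_smul, smul_sub,
      smul_add, mul_assoc, mul_smul_comm, smul_mul_assoc]
    abel

end IsItoExpansion

end Expansion

/-! ### Elements anticommuting with a given set. -/

section Anticommutant

variable {𝒜 : Type*} [CStarAlgebra 𝒜]

/-- The elements that anticommute with every element of `S`. -/
def anticommutant (S : Set 𝒜) : Submodule ℝ 𝒜 where
  carrier := {a | ∀ x ∈ S, a * x = -(x * a)}
  add_mem' {a b} ha hb x hx := by rw [add_mul, mul_add, ha x hx, hb x hx]; abel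
  zero_mem' x _ := by simp
  smul_mem' r a ha x hx := by rw [smul_mul_assoc, ha x hx, mul_smul_comm, smul_neg]

theorem mem_anticommutant {S : Set 𝒜} {a : 𝒜} :
    a ∈ anticommutant S ↔ ∀ x ∈ S, a * x = -(x * a) := Iff.rfl

theorem isClosed_anticommutant (S : Set 𝒜) : IsClosed (anticommutant S : Set 𝒜) := by
  have : (anticommutant S : Set 𝒜) = ⋂ x ∈ S, {a | a * x = -(x * a)} := by
    ext a; simp [mem_anticommutant]
  rw [this]
  exact isClosed_biInter fun x _ => isClosed_eq (by fun_prop) (by fun_prop)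

/-- Two sign changes cancel but three leave one sign; this is why stability under triple products,
rather than under products, is the condition used for solutions. -/
theorem mul_mul_mem_anticommutant {S : Set 𝒜} {a b c : 𝒜} (ha : a ∈ anticommutant S)
    (hb : b ∈ anticommutant S) (hc : c ∈ anticommutant S) : a * b * c ∈ anticommutant S := by
  intro x hx
  rw [mul_assoc, hc x hx, mul_neg, ← mul_assoc, mul_assoc a, hb x hx, mul_neg, ← mul_assoc a,
    ha x hx]
  noncomm_ring

end Anticommutant

/-! ### Uniqueness for a finite-dimensional linear equation. -/

section Gronwall

/-- Linear functionals `δ s` on a finite-dimensional space that satisfy the linear equation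
`δ' = δ ∘ L` with `δ 0 = 0` vanish. -/
theorem eq_zero_of_hasDerivWithinAt_comp {M : Type*} [AddCommGroup M] [Module ℝ M] {ι : Type*}
    [Fintype ι] (b : Module.Basis ι ℝ M) (L : M →ₗ[ℝ] M) {T : ℝ} (δ : ℝ → M →ₗ[ℝ] ℂ)
    (hcont : ∀ G, ContinuousOn (fun s => δ s G) (Set.Icc 0 T))
    (hderiv : ∀ s ∈ Set.Ico 0 T, ∀ G,
      HasDerivWithinAt (fun r => δ r G) (δ s (L G)) (Set.Ici s) s)
    (h0 : ∀ G, δ 0 G = 0) {t : ℝ} (ht : t ∈ Set.Icc 0 T) (G : M) : δ t G = 0 := by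
  set φ : ℝ → ι → ℂ := fun s i => δ s (b i)
  have hbound : ∀ s G, ‖δ s G‖ ≤ (∑ i, ‖b.repr G i‖) * ‖φ s‖ := by
    intro s G
    conv_lhs => rw [← b.sum_repr G]
    rw [map_sum, Finset.sum_mul]
    refine (norm_sum_le _ _).trans (Finset.sum_le_sum fun i _ => ?_)
    rw [map_smul, norm_smul]
    exact mul_le_mul_of_nonneg_left (norm_le_pi_norm (φ s) i) (norm_nonneg _)
  have hφ : φ t = 0 := by
    have := norm_le_gronwallBound_of_norm_deriv_right_le (f := φ) (δ := 0)
      (K := ∑ j, ∑ i, ‖b.repr (L (b j)) i‖) (ε := 0) (a := 0) (b := T)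
      (f' := fun s i => δ s (L (b i)))
      (continuousOn_pi.mpr fun i => hcont (b i))
      (fun s hs => hasDerivWithinAt_pi.mpr fun i => hderiv s hs (b i))
      (by rw [show φ 0 = 0 from funext fun i => h0 (b i), norm_zero])
      (fun s _ => by
        rw [add_zero]
        refine (pi_norm_le_iff_of_nonneg (by positivity)).mpr fun j => (hbound s _).trans ?_
        refine mul_le_mul_of_nonneg_right ?_ (norm_nonneg _)
        exact Finset.single_le_sum (f := fun j => ∑ i, ‖b.repr (L (b j)) i‖)
          (fun j _ => Finset.sum_nonneg fun i _ => norm_nonneg _) (Finset.mem_univ j)) t ht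
    rw [gronwallBound_ε0_δ0] at this
    exact norm_le_zero_iff.mp this
  have := hbound t G
  rw [hφ, norm_zero, mul_zero] at this
  exact norm_le_zero_iff.mp this

end Gronwall

/-! ### Adaptedness and the evolution equation of the weighted state. -/

section Main

open Asymptotics Filter Topology

variable {V 𝒜 : Type*} [NormedAddCommGroup V] [InnerProductSpace ℝ V]
  [CStarAlgebra 𝒜] {ω : 𝒜 →L[ℂ] ℂ} {C : V →L[ℝ] V}
  {F : V →ₗ[ℝ] ExteriorAlgebra ℝ V} {B : ℝ → GrassmannVar V 𝒜} {Ψ₀ : GrassmannVar V 𝒜} {T : ℝ}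
  {Ψ : ℝ → GrassmannVar V 𝒜}

/-- The solution is adapted and anticommutes with the future increments of the noise. -/
theorem IsSolution.adapted [FiniteDimensional ℝ V] (hΨ : IsSolution F B Ψ₀ T Ψ) (hF : ∀ v, F v ∈ oddPart V)
    (hB : IsBrownianMotion ω B C) (hindep : IsIndependentOfProcess ω Ψ₀ B) {t : ℝ}
    (ht : t ∈ Set.Icc 0 T) (v : V) :
    Ψ t (ExteriorAlgebra.ι ℝ v) ∈ past Ψ₀ B t ∧ ∀ h, 0 ≤ h → ∀ w,
      Ψ t (ExteriorAlgebra.ι ℝ v) * increment B t h w =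
        -(increment B t h w * Ψ t (ExteriorAlgebra.ι ℝ v)) := by
  set S : Set 𝒜 := {x | ∃ h : ℝ, 0 ≤ h ∧ ∃ w : V, x = increment B t h w}
  have hmem : Ψ t (ExteriorAlgebra.ι ℝ v) ∈ Subalgebra.toSubmodule (past Ψ₀ B t) ⊓
      anticommutant S := by
    refine hΨ.mem_of_isClosed hF ht _ ((isClosed_past Ψ₀ B t).inter (isClosed_anticommutant S))
      ?_ ?_ ?_ v
    · rintro a ⟨ha, ha'⟩ b ⟨hb, hb'⟩ c ⟨hc, hc'⟩
      exact ⟨mul_mem (S := Subalgebra ℝ 𝒜) (mul_mem (S := Subalgebra ℝ 𝒜) ha hb) hc,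
        mul_mul_mem_anticommutant ha' hb' hc'⟩
    · refine fun v => ⟨ι_mem_past Ψ₀ B t v, ?_⟩
      rintro x ⟨h, hh, w, rfl⟩
      rw [increment, mul_sub, sub_mul, hindep.anticommute (add_nonneg ht.1 hh),
        hindep.anticommute ht.1]
      abel
    · refine fun s hs v => ⟨process_mem_past Ψ₀ B hs v, ?_⟩
      rintro x ⟨h, hh, w, rfl⟩
      rw [increment, mul_sub, sub_mul, hB.anticommute hs.1 (add_nonneg ht.1 hh),
        hB.anticommute hs.1 ht.1]
      abel
  exact ⟨hmem.1, fun h hh w => hmem.2 _ ⟨h, hh, w, rfl⟩⟩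

theorem exp_mem_past (Ψ₀ : GrassmannVar V 𝒜) (B : ℝ → GrassmannVar V 𝒜) (t : ℝ)
    (U : ExteriorAlgebra ℝ V) : NormedSpace.exp ((-2 : ℝ) • Ψ₀ U) ∈ past Ψ₀ B t :=
  (isClosed_past Ψ₀ B t).mem_of_tendsto (tendsto_expPartial Ψ₀ U)
    (Eventually.of_forall fun _ => apply_mem_of_ι_mem Ψ₀ _ (ι_mem_past Ψ₀ B t) _)

/-- Right differentiability of `Ψ - B` gives the expansion. The element `Ψ_t(G) E` belongs to the
past, so the conditional moments of the increments apply to it, and `E` commutes with the noise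
because `U` is even. -/
theorem IsSolution.isItoExpansion [FiniteDimensional ℝ V] [CompleteSpace V]
    (hΨ : IsSolution F B Ψ₀ T Ψ) (hF : ∀ v, F v ∈ oddPart V)
    (hB : IsBrownianMotion ω B C) (hindep : IsIndependentOfProcess ω Ψ₀ B)
    {U : ExteriorAlgebra ℝ V} (hU : U ∈ evenPart V) {t : ℝ} (ht : t ∈ Set.Ico 0 T) :
    IsItoExpansion ω F C (Ψ t) (fun h => Ψ (t + h)) (increment B t)
      (NormedSpace.exp ((-2 : ℝ) • Ψ₀ U)) := by
  have ht' : t ∈ Set.Icc 0 T := ⟨ht.1, ht.2.le⟩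
  have had := fun v => hΨ.adapted hF hB hindep ht' v
  have hpast : ∀ G : ExteriorAlgebra ℝ V,
      Ψ t G * NormedSpace.exp ((-2 : ℝ) • Ψ₀ U) ∈ past Ψ₀ B t := fun G =>
    mul_mem (apply_mem_of_ι_mem (Ψ t) _ (fun v => (had v).1) G) (exp_mem_past Ψ₀ B t U)
  refine ⟨fun v => ?_, fun v => ?_, fun h hh v w => (had v).2 h hh.le w, fun h hh v => ?_,
    fun h hh G v => (hB.increment_past hindep ht.1 hh.le v v (hpast G)).1,
    fun h hh G v w => (hB.increment_past hindep ht.1 hh.le v w (hpast G)).2⟩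
  · have hd := hasDerivWithinAt_iff_isLittleO.mp (hΨ.hasDerivWithinAt v ht)
    have htend : Tendsto (fun h : ℝ => t + h) (𝓝[>] 0) (𝓝[≥] t) := by
      refine tendsto_nhdsWithin_iff.mpr ⟨?_, ?_⟩
      · have : Tendsto (fun h : ℝ => t + h) (𝓝 0) (𝓝 (t + 0)) :=
          (continuous_const.add continuous_id).tendsto 0
        rw [add_zero] at this
        exact this.mono_left nhdsWithin_le_nhds
      · filter_upwards [self_mem_nhdsWithin] with h hh
        exact le_add_of_nonneg_right (le_of_lt (Set.mem_Ioi.mp hh))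
    refine (hd.comp_tendsto htend).congr (fun h => ?_) (fun h => ?_)
    · simp only [Function.comp_apply, add_sub_cancel_left, increment]
      abel
    · simp
  · obtain ⟨K, hK, hle⟩ := hB.exists_norm_increment_le
    refine IsBigO.of_bound (K * ‖v‖) ?_
    filter_upwards [self_mem_nhdsWithin] with h hh
    rw [Real.norm_of_nonneg (Real.sqrt_nonneg h)]
    refine (hle t h ht.1 (le_of_lt (Set.mem_Ioi.mp hh)) v).trans (le_of_eq (by ring))
  · refine Commute.exp_left (Commute.smul_left (commute_of_even Ψ₀ (fun w => ?_) hU) _)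
    rw [increment, mul_sub, sub_mul, hindep.anticommute (add_nonneg ht.1 hh.le),
      hindep.anticommute ht.1]
    abel

theorem IsSolution.hasDerivWithinAt_state [FiniteDimensional ℝ V] [CompleteSpace V]
    (hΨ : IsSolution F B Ψ₀ T Ψ)
    (hF : ∀ v, F v ∈ oddPart V) (hC : ∀ v w : V, inner ℝ (C v) w = -inner ℝ v (C w))
    (hB : IsBrownianMotion ω B C) (hindep : IsIndependentOfProcess ω Ψ₀ B)
    {U : ExteriorAlgebra ℝ V} (hU : U ∈ evenPart V) {t : ℝ} (ht : t ∈ Set.Ico 0 T)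
    (G : ExteriorAlgebra ℝ V) :
    HasDerivWithinAt (fun s => ω (Ψ s G * NormedSpace.exp ((-2 : ℝ) • Ψ₀ U)))
      (ω (Ψ t (generator F C G) * NormedSpace.exp ((-2 : ℝ) • Ψ₀ U))) (Set.Ici t) t := by
  -- The auxiliary factor `H` served only the induction, so it is set to `1`.
  have h := (hΨ.isItoExpansion hF hB hindep hU ht).state_expansion hF hC G 1
  rw [← hasDerivWithinAt_Ioi_iff_Ici, hasDerivWithinAt_iff_isLittleO]
  have htend : Tendsto (fun s : ℝ => s - t) (𝓝[>] t) (𝓝[>] 0) := by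
    refine tendsto_nhdsWithin_iff.mpr ⟨?_, ?_⟩
    · have : Tendsto (fun s : ℝ => s - t) (𝓝 t) (𝓝 (t - t)) :=
        (continuous_id.sub continuous_const).tendsto t
      rw [sub_self] at this
      exact this.mono_left nhdsWithin_le_nhds
    · filter_upwards [self_mem_nhdsWithin] with s hs
      exact sub_pos.mpr (Set.mem_Ioi.mp hs)
  refine (h.comp_tendsto htend).congr (fun s => ?_) (fun s => rfl)
  simp only [Function.comp_apply, map_one, one_mul, add_sub_cancel]

theorem IsSolution.apply_zero [CompleteSpace V] (hΨ : IsSolution F B Ψ₀ T Ψ) (hT : 0 ≤ T)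
    (hB : IsBrownianMotion ω B C) : Ψ 0 = Ψ₀ := by
  refine ExteriorAlgebra.hom_ext (LinearMap.ext fun v => ?_)
  have := hΨ.equation 0 ⟨le_rfl, hT⟩ v
  rwa [intervalIntegral.integral_same, add_zero, hB.apply_zero, add_zero] at this

end Main

end GrassmannSDE

end

theorem theorem35 {V 𝒜 : Type*} [NormedAddCommGroup V] [InnerProductSpace ℝ V]
    [FiniteDimensional ℝ V] [CompleteSpace V] [CStarAlgebra 𝒜]
    (ω : 𝒜 →L[ℂ] ℂ) (hω : GrassmannSDE.IsState ω)
    (A C : V →L[ℝ] V) (hC : ∀ v w : V, inner ℝ (C v) w = -inner ℝ v (C w))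
    (hint : MeasureTheory.IntegrableOn (GrassmannSDE.covIntegrand A C) (Set.Ioi (0 : ℝ)))
    (U : ExteriorAlgebra ℝ V) (hU : U ∈ GrassmannSDE.evenPart V)
    (B : ℝ → GrassmannSDE.GrassmannVar V 𝒜) (hB : GrassmannSDE.IsBrownianMotion ω B C)
    (Ψ₀ : GrassmannSDE.GrassmannVar V 𝒜)
    (hΨ₀ : GrassmannSDE.IsGaussian ω Ψ₀ (GrassmannSDE.stationaryCov A C))
    (hindep : GrassmannSDE.IsIndependentOfProcess ω Ψ₀ B)
    (hcomm : ContinuousLinearMap.adjoint A ∘L GrassmannSDE.stationaryCov A C =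
      GrassmannSDE.stationaryCov A C ∘L A) :
    GrassmannSDE.IsInvariantMeasure
      (GrassmannSDE.weighted ω (NormedSpace.exp ((-2 : ℝ) • Ψ₀ U)))
      (GrassmannSDE.drift A C U) B Ψ₀ := by
  intro T Ψ hT hΨ G t ht
  have hF := GrassmannSDE.drift_mem_oddPart A C hU
  set E : 𝒜 := NormedSpace.exp ((-2 : ℝ) • Ψ₀ U)
  set ρ : 𝒜 →ₗ[ℝ] ℂ := (GrassmannSDE.weighted ω E : 𝒜 →ₗ[ℂ] ℂ).restrictScalars ℝ
  have hρ : ∀ a, ρ a = ω (a * E) := fun a => rfl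
  -- Subtracting the initial functional keeps the equation `δ' = δ ∘ L`, since that functional kills
  -- the range of `L`, and makes the initial value zero.
  have hzero := GrassmannSDE.eq_zero_of_hasDerivWithinAt_comp
    (stdOrthonormalBasis ℝ V).toBasis.ExteriorAlgebra
    (GrassmannSDE.generator (GrassmannSDE.drift A C U) C) (T := T)
    (fun s => ρ ∘ₗ (Ψ s).toLinearMap - ρ ∘ₗ Ψ₀.toLinearMap)
    (fun G => by
      simp only [LinearMap.sub_apply, LinearMap.comp_apply, AlgHom.toLinearMap_apply, hρ]
      exact (ω.continuous.comp_continuousOn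
        ((hΨ.continuousOn_apply G).mul continuousOn_const)).sub continuousOn_const)
    (fun s hs G => by
      simp only [LinearMap.sub_apply, LinearMap.comp_apply, AlgHom.toLinearMap_apply, hρ]
      rw [GrassmannSDE.weighted_generator_eq_zero hint hcomm hU hΨ₀, sub_zero]
      exact (hΨ.hasDerivWithinAt_state hF hC hB hindep hU hs G).sub_const _)
    (fun G => by rw [hΨ.apply_zero hT.le hB, sub_self, LinearMap.zero_apply]) ht G
  exact sub_eq_zero.mp hzero
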